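/- Let $d\in\mathbb N$. For $z=(z_1,z_2)\in\mathbb R^{2d}$ let $\pi(z)f(t)=e^{2\pi i t\cdot z_2}f(t-z_1)$, and for $g\in\mathcal S(\mathbb R^d)\setminus\{0\}$, $f\in\mathcal S'(\mathbb R^d)$ let $V_gf(z)=\langle f,\pi(z)g\rangle$ be the short-time Fourier transform, where $\langle\cdot,\cdot\rangle$ extends $\int f\,\overline{g}\,dt$. For $s\ge 0$ put $v_s(z)=(1+|z|^2)^{s/2}$; a measurable function $m:\mathbb R^{2d}\to(0,\infty)$ is called $v_s$-moderate with constant $K$ if $m(z+\zeta)\le K\,v_s(z)\,m(\zeta)$ for all $z,\zeta\in\mathbb R^{2d}$. For $1\le p\le\infty$ let $M^p_m(\mathbb R^d)$ be the space of all $f\in\mathcal S'(\mathbb R^d)$ with $\|f\|_{M^p_m}=\|V_gf\cdot m\|_{L^p(\mathbb R^{2d})}<\infty$. Let $\mathcal A\in Sp(d,\mathbb R)$, and let $\mu(\mathcal A)$ be a metaplectic operator associated with $\mathcal A$, that is, a unitary operator on $L^2(\mathbb R^d)$ such that for every $z\in\mathbb R^{2d}$ there is $c_{\mathcal A,z}\in\mathbb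 C$ with $|c_{\mathcal A,z}|=1$ and $$\pi(\mathcal A z)=c_{\mathcal A,z}\,\mu(\mathcal A)\,\pi(z)\,\mu(\mathcal A)^{-1}.$$ Then $\mu(\mathcal A)$ extends to a weak-$*$ continuous linear operator on $\mathcal S'(\mathbb R^d)$, again denoted by $\mu(\mathcal A)$, and for every window $g\in\mathcal S(\mathbb R^d)\setminus\{0\}$, every $s\ge 0$ and every $K$ there is a constant $C<\infty$ (depending only on $d$, $\mu(\mathcal A)$, $g$, $s$, $K$) such that, for every $v_s$-moderate weight $m$ with constant $K$ and every $1\le p\le\infty$, $\mu(\mathcal A)$ maps $M^p_{m\circ\mathcal A}(\mathbb R^d)$ into $M^p_m(\mathbb R^d)$ and $$\|\mu(\mathcal A)f\|_{M^p_m}\le C\,\|f\|_{M^p_{m\circ\mathcal A}}\qquad\text{for all } f\in M^p_{m\circ\mathcal A}(\mathbb R^d).$$ -/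

import Mathlib

open MeasureTheory SchwartzMap Matrix
open scoped ENNReal NNReal

noncomputable section

namespace TimeFreq

/-- Configuration space `ℝ^d`, with its Euclidean norm and Lebesgue measure. -/
abbrev Config (d : ℕ) := EuclideanSpace ℝ (Fin d)

/-- Phase space `ℝ^{2d}`, with its Euclidean norm and Lebesgue measure. The first summand of the
index type carries the position `z₁`, the second one the frequency `z₂`. -/
abbrev Phase (d : ℕ) := EuclideanSpace ℝ (Fin d ⊕ Fin d)

/-- The position part `z₁` of `z = (z₁, z₂)`. -/
def pos {d : ℕ} (z : Phase d) : Config d := WithLp.toLp 2 fun i => z (Sum.inl i)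

/-- The frequency part `z₂` of `z = (z₁, z₂)`. -/
def freq {d : ℕ} (z : Phase d) : Config d := WithLp.toLp 2 fun i => z (Sum.inr i)

/-- The modulation factor `t ↦ e^{2πi t·z₂}`. -/
def modFactor {d : ℕ} (z : Phase d) (t : Config d) : ℂ :=
  Complex.exp ((2 * Real.pi * inner ℝ t (freq z) : ℝ) * Complex.I)

/-- The time-frequency shift on functions, `(π(z) f)(t) = e^{2πi t·z₂} f(t - z₁)`. -/
def tfShift {d : ℕ} (z : Phase d) (f : Config d → ℂ) : Config d → ℂ :=
  fun t => modFactor z t * f (t - pos z)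

theorem norm_modFactor {d : ℕ} (z : Phase d) (t : Config d) : ‖modFactor z t‖ = 1 :=
  Complex.norm_exp_ofReal_mul_I _

theorem continuous_modFactor {d : ℕ} (z : Phase d) : Continuous (modFactor z) := by
  unfold modFactor
  fun_prop

theorem iteratedDeriv_expI (n : ℕ) :
    iteratedDeriv n (fun x : ℝ => Complex.exp (x * Complex.I)) =
      fun x : ℝ => Complex.I ^ n * Complex.exp (x * Complex.I) := by
  induction n with
  | zero => simp
  | succ n ih =>
    rw [iteratedDeriv_succ, ih]
    funext x
    have h : HasDerivAt (fun y : ℝ => Complex.exp ((y : ℂ) * Complex.I))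
        (Complex.exp ((x : ℂ) * Complex.I) * (1 * Complex.I)) x :=
      ((Complex.ofRealCLM.hasDerivAt (x := x)).mul_const Complex.I).cexp
    rw [(h.const_mul (Complex.I ^ n)).deriv]
    ring

theorem hasTemperateGrowth_expI :
    Function.HasTemperateGrowth (fun x : ℝ => Complex.exp (x * Complex.I)) := by
  refine ⟨?_, fun n => ⟨0, 1, fun x => ?_⟩⟩
  · exact (Complex.ofRealCLM.contDiff.mul contDiff_const).cexp
  · rw [norm_iteratedFDeriv_eq_norm_iteratedDeriv, iteratedDeriv_expI]
    simp [Complex.norm_exp_ofReal_mul_I]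

theorem hasTemperateGrowth_modFactor {d : ℕ} (z : Phase d) :
    Function.HasTemperateGrowth (modFactor z) := by
  have h : Function.HasTemperateGrowth
      (fun t : Config d => 2 * Real.pi * inner ℝ t (freq z)) := by fun_prop
  exact hasTemperateGrowth_expI.comp h

theorem memLp_tfShift {d : ℕ} (z : Phase d) {f : Config d → ℂ} (hf : MemLp f 2 volume) :
    MemLp (tfShift z f) 2 volume := by
  have h : MemLp (fun t => f (t - pos z)) 2 volume :=
    hf.comp_measurePreserving (measurePreserving_sub_right volume (pos z))
  refine h.of_le ((continuous_modFactor z).aestronglyMeasurable.mul h.1)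
    (Filter.Eventually.of_forall fun t => ?_)
  simp [tfShift, norm_modFactor]

/-- The Hilbert space `L²(ℝ^d)`. -/
abbrev L2 (d : ℕ) := Lp ℂ 2 (volume : Measure (Config d))

/-- The time-frequency shift `π(z)` on `L²(ℝ^d)`. -/
def tfShiftL2 {d : ℕ} (z : Phase d) (f : L2 d) : L2 d :=
  (memLp_tfShift z (Lp.memLp f)).toLp (tfShift z f)

/-- The time-frequency shift `π(z)` on the Schwartz space. -/
def tfShiftS {d : ℕ} (z : Phase d) (g : 𝓢(Config d, ℂ)) : 𝓢(Config d, ℂ) :=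
  smulLeftCLM ℂ (modFactor z) (compSubConstCLM ℂ (pos z) g)

theorem tfShiftS_apply {d : ℕ} (z : Phase d) (g : 𝓢(Config d, ℂ)) (t : Config d) :
    tfShiftS z g t = tfShift z g t := by
  simp [tfShiftS, tfShift, smulLeftCLM_apply_apply (hasTemperateGrowth_modFactor z)]

/-- Complex conjugation on the Schwartz space. -/
def conjS {d : ℕ} (g : 𝓢(Config d, ℂ)) : 𝓢(Config d, ℂ) :=
  postcompCLM (𝕜 := ℝ) (Complex.conjCLE : ℂ →L[ℝ] ℂ) g

theorem conjS_apply {d : ℕ} (g : 𝓢(Config d, ℂ)) (t : Config d) :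
    conjS g t = starRingEnd ℂ (g t) := rfl

/-- The bracket `⟨f, φ⟩` on `𝓢' × 𝓢`, linear in `f` and antilinear in `φ`; it extends
`∫ f(t) conj(φ(t)) dt`. -/
def bracket {d : ℕ} (f : 𝓢'(Config d, ℂ)) (φ : 𝓢(Config d, ℂ)) : ℂ := f (conjS φ)

/-- The short-time Fourier transform `V_g f(z) = ⟨f, π(z) g⟩` of a tempered distribution. -/
def stft {d : ℕ} (g : 𝓢(Config d, ℂ)) (f : 𝓢'(Config d, ℂ)) (z : Phase d) : ℂ :=
  bracket f (tfShiftS z g)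

/-- The weight `v_s(z) = (1 + |z|²)^{s/2}` on phase space. -/
def polyWeight {d : ℕ} (s : ℝ) (z : Phase d) : ℝ := (1 + ‖z‖ ^ 2) ^ (s / 2)

/-- `m` is a `v_s`-moderate weight with moderateness constant `K`; the `v_s`-moderate weights are
the functions for which this holds for some `K`. -/
structure IsModerate {d : ℕ} (s K : ℝ) (m : Phase d → ℝ) : Prop where
  measurable : Measurable m
  pos : ∀ z, 0 < m z
  moderate : ∀ z ζ, m (z + ζ) ≤ K * polyWeight s z * m ζ

/-- The modulation space norm `‖f‖_{M^p_m} = ‖V_g f · m‖_{L^p}` for the window `g`, with value `∞`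
if `f` is not in the space. -/
def modNorm {d : ℕ} (g : 𝓢(Config d, ℂ)) (p : ℝ≥0∞) (m : Phase d → ℝ)
    (f : 𝓢'(Config d, ℂ)) : ℝ≥0∞ :=
  eLpNorm (fun z => stft g f z * (m z : ℂ)) p volume

/-- The modulation space `M^p_m(ℝ^d)`: the tempered distributions `f` with `V_g f · m ∈ L^p`. -/
def modSpace {d : ℕ} (g : 𝓢(Config d, ℂ)) (p : ℝ≥0∞) (m : Phase d → ℝ) :
    Submodule ℂ (𝓢'(Config d, ℂ)) where
  carrier := {f | MemLp (fun z => stft g f z * (m z : ℂ)) p volume}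
  zero_mem' := by
    have h : (fun z => stft g (0 : 𝓢'(Config d, ℂ)) z * (m z : ℂ)) = fun _ => 0 := by
      funext z
      change (0 : ℂ) * _ = 0
      simp
    change MemLp _ p volume
    rw [h]
    exact MemLp.zero
  add_mem' {f₁ f₂} h₁ h₂ := by
    have h : (fun z => stft g (f₁ + f₂) z * (m z : ℂ)) =
        (fun z => stft g f₁ z * (m z : ℂ)) + fun z => stft g f₂ z * (m z : ℂ) := by
      funext z
      change (stft g f₁ z + stft g f₂ z) * _ = _
      simp [add_mul]
    change MemLp _ p volume
    rw [h]
    exact MemLp.add h₁ h₂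
  smul_mem' c f hf := by
    have h : (fun z => stft g (c • f) z * (m z : ℂ)) =
        c • fun z => stft g f z * (m z : ℂ) := by
      funext z
      change (c * stft g f z) * _ = _
      simp [mul_assoc]
    change MemLp _ p volume
    rw [h]
    exact MemLp.const_smul hf c

/-- The action `z ↦ 𝒜 z` of a `2d × 2d` matrix on phase space. -/
def act {d : ℕ} (A : Matrix (Fin d ⊕ Fin d) (Fin d ⊕ Fin d) ℝ) (z : Phase d) : Phase d :=
  Matrix.toEuclideanLin A z

/-- The unitary operator `U` on `L²(ℝ^d)` is a metaplectic operator `μ(𝒜)` for the symplectic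
matrix `𝒜`: it satisfies the intertwining relation `π(𝒜 z) = c U π(z) U⁻¹` for all `z`, with phase
factors `c = c_{𝒜,z}` of modulus one. -/
def IsMetaplectic {d : ℕ} (A : Matrix.symplecticGroup (Fin d) ℝ) (U : L2 d ≃ₗᵢ[ℂ] L2 d) : Prop :=
  ∀ z : Phase d, ∃ c : ℂ, ‖c‖ = 1 ∧
    ∀ f : L2 d, tfShiftL2 (act (A : Matrix _ _ ℝ) z) f = c • U (tfShiftL2 z (U.symm f))

/-- `T` is the extension of the operator `U` from `L²(ℝ^d)` to `𝓢'(ℝ^d)`. As a member of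
`𝓢' →L[ℂ] 𝓢'` it is linear and weak-* continuous, hence determined by `U`, since `L²` is
weak-* dense in `𝓢'`. -/
def IsTemperedExtension {d : ℕ} (U : L2 d ≃ₗᵢ[ℂ] L2 d)
    (T : 𝓢'(Config d, ℂ) →L[ℂ] 𝓢'(Config d, ℂ)) : Prop :=
  ∀ f : L2 d, T (Lp.toTemperedDistribution f) = Lp.toTemperedDistribution (U f)

end TimeFreq

end

noncomputable section

namespace TimeFreq

open scoped ComplexConjugate FourierTransform ContDiff

variable {d : ℕ}

/-! Write `W = μ(𝒜)⁻¹` and `B = 𝒜⁻¹`. Since `W` is unitary and carries `π(z)` to a unimodular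
multiple of `π(Bz)`, it satisfies `|V_{Wg}(Wf)(Bz)| = |V_g f(z)|` on `L²`. Everything follows from
this covariance once `W` is known to act continuously on the Schwartz space.

For Schwartz `f ≠ 0` and `u = Wf`, covariance makes the ambiguity function `V_u u` decay rapidly.
The orthogonality relations `integral_stftFun_mul_conj` write `V_φ u(z) · conj (V_φ u(w))` as the
pairing of `V_u u` with `V_{π(w)φ}(π(z)φ)`. Fixing `w` with `V_φ u(w) ≠ 0` passes the decay on to
`V_φ u` (`stftFun_decay_of_ambiguity`), and the inversion formula then exhibits `u` as a Schwartz
function (`exists_schwartz_of_stftFun`). Weighted `L¹` norms of the transform dominate the Schwartz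
seminorms (`seminorm_le_integral_stftFun`), so the restriction `P` of `W` is continuous
(`Intertwines.exists_schwartzCLM`).

The extension `T` of `μ(𝒜)` is the transpose of `P` conjugated by complex conjugation. It satisfies
`|V_g(Tf)(z)| = |V_{Pg} f(𝒜⁻¹z)|`. As `𝒜` preserves Lebesgue measure, the `M^p_m` norm of `Tf` with
window `g` equals the `M^p_{m∘𝒜}` norm of `f` with window `Pg`. It remains to replace `Pg` by `g`
(`modNorm_le_of_window`): up to the factor `‖g‖₂⁻²`, `|V_h f|` is bounded by the convolution of
`|V_g f|` with `|V_h g|`. Moderateness moves the weight inside, and Young's inequality gives a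
constant independent of `p` and `m`. For distributional `f` the bound rests on an inversion formula,
obtained by representing `f` as a superposition of time-frequency shifts
(`exists_stftFun_representation`). -/

/-! ### Phase space as position times frequency -/

/-- The measurable identification of phase space with the product of position and frequency. -/
def phaseEquiv (d : ℕ) : Phase d ≃ᵐ Config d × Config d :=
  (MeasurableEquiv.toLp 2 (Fin d ⊕ Fin d → ℝ)).symm.trans
    ((MeasurableEquiv.sumPiEquivProdPi fun _ => ℝ).trans
      ((MeasurableEquiv.toLp 2 (Fin d → ℝ)).prodCongr (MeasurableEquiv.toLp 2 (Fin d → ℝ))))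

theorem phaseEquiv_apply (z : Phase d) : phaseEquiv d z = (pos z, freq z) := rfl

theorem measurePreserving_phaseEquiv (d : ℕ) : MeasurePreserving (phaseEquiv d) := by
  have h1 := PiLp.volume_preserving_ofLp (Fin d ⊕ Fin d)
  have h2 := volume_measurePreserving_sumPiEquivProdPi (fun _ : Fin d ⊕ Fin d => ℝ)
  have h3 := PiLp.volume_preserving_toLp (Fin d)
  exact (h3.prod h3).comp (h2.comp h1)

theorem norm_sq_eq_pos_freq (z : Phase d) : ‖z‖ ^ 2 = ‖pos z‖ ^ 2 + ‖freq z‖ ^ 2 := by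
  simp [EuclideanSpace.norm_sq_eq, pos, freq]

theorem norm_pos_le (z : Phase d) : ‖pos z‖ ≤ ‖z‖ := by
  nlinarith [norm_sq_eq_pos_freq z, norm_nonneg (pos z), norm_nonneg z, sq_nonneg ‖freq z‖]

theorem norm_freq_le (z : Phase d) : ‖freq z‖ ≤ ‖z‖ := by
  nlinarith [norm_sq_eq_pos_freq z, norm_nonneg (freq z), norm_nonneg z, sq_nonneg ‖pos z‖]

theorem one_add_norm_le_pos_freq (z : Phase d) :
    1 + ‖z‖ ≤ (1 + ‖pos z‖) * (1 + ‖freq z‖) := by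
  have h := norm_sq_eq_pos_freq z
  have h1 := norm_nonneg (pos z)
  have h2 := norm_nonneg (freq z)
  have : ‖z‖ ≤ ‖pos z‖ + ‖freq z‖ := by
    refine abs_le_of_sq_le_sq' ?_ (by positivity) |>.2
    nlinarith
  nlinarith

theorem one_add_norm_le_mul {E : Type*} [SeminormedAddCommGroup E] (x y : E) :
    1 + ‖x‖ ≤ (1 + ‖y‖) * (1 + ‖y - x‖) := by
  have : ‖x‖ ≤ ‖y‖ + ‖y - x‖ := by
    simpa using norm_sub_le y (y - x)
  nlinarith [mul_nonneg (norm_nonneg y) (norm_nonneg (y - x))]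

theorem pos_sub (z w : Phase d) : pos (z - w) = pos z - pos w := rfl
theorem freq_sub (z w : Phase d) : freq (z - w) = freq z - freq w := rfl

@[fun_prop]
theorem continuous_pos : Continuous (pos : Phase d → Config d) := by
  unfold pos; fun_prop

@[fun_prop]
theorem continuous_freq : Continuous (freq : Phase d → Config d) := by
  unfold freq; fun_prop

/-- The phase space point with given position and frequency. -/
def phaseMk (x η : Config d) : Phase d := WithLp.toLp 2 (Sum.elim x η)

@[simp] theorem pos_phaseMk (x η : Config d) : pos (phaseMk x η) = x := rfl
@[simp] theorem freq_phaseMk (x η : Config d) : freq (phaseMk x η) = η := rfl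

theorem modFactor_eq_fourierChar (z : Phase d) (t : Config d) :
    modFactor z t = (Real.fourierChar (inner ℝ t (freq z)) : ℂ) := by
  rw [modFactor, Real.fourierChar_apply]

/-! ### The short-time Fourier transform of functions -/

/-- The short-time Fourier transform of a function, as an integral. -/
def stftFun (g f : Config d → ℂ) (z : Phase d) : ℂ := ∫ t, f t * conj (tfShift z g t)

theorem stftFun_eq_fourier (g f : Config d → ℂ) (z : Phase d) :
    stftFun g f z = 𝓕 (fun t => f t * conj (g (t - pos z))) (freq z) := by
  rw [stftFun, Real.fourier_eq]
  refine integral_congr_ae (Filter.Eventually.of_forall fun t => ?_)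
  simp only [tfShift, modFactor_eq_fourierChar, map_mul, AddChar.map_neg_eq_inv, Circle.smul_def,
    smul_eq_mul, Circle.coe_inv_eq_conj]
  ring

theorem norm_tfShift (z : Phase d) (g : Config d → ℂ) (t : Config d) :
    ‖tfShift z g t‖ = ‖g (t - pos z)‖ := by
  simp [tfShift, norm_modFactor]

theorem stronglyMeasurable_tfShift {g : Config d → ℂ} (hg : StronglyMeasurable g) :
    StronglyMeasurable (fun p : Phase d × Config d => tfShift p.1 g p.2) := by
  unfold tfShift modFactor
  refine StronglyMeasurable.mul (Continuous.stronglyMeasurable (by fun_prop)) ?_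
  exact hg.comp_measurable (by fun_prop : Continuous fun p : Phase d × Config d =>
    p.2 - pos p.1).measurable

theorem stronglyMeasurable_stftFun {g f : Config d → ℂ} (hg : StronglyMeasurable g)
    (hf : StronglyMeasurable f) : StronglyMeasurable (stftFun g f) := by
  unfold stftFun
  refine StronglyMeasurable.integral_prod_right (f := fun z t => f t * conj (tfShift z g t)) ?_
  refine StronglyMeasurable.mul (hf.comp_measurable measurable_snd) ?_
  exact Complex.continuous_conj.comp_stronglyMeasurable (stronglyMeasurable_tfShift hg)

theorem _root_.SchwartzMap.stronglyMeasurable (g : 𝓢(Config d, ℂ)) : StronglyMeasurable g :=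
  g.continuous.stronglyMeasurable

/-! ### Rapid decay for Schwartz functions -/

/-- Spending `μ.integrablePower` extra orders of decay leaves an integrable power of `1 + ‖x‖` as
majorant. -/
theorem integrable_of_decay {E F : Type*} [NormedAddCommGroup E] [NormedSpace ℝ E]
    [FiniteDimensional ℝ E] [MeasurableSpace E] [BorelSpace E] [NormedAddCommGroup F]
    {μ : Measure E} [μ.HasTemperateGrowth]
    {f : E → F} (hf : AEStronglyMeasurable f μ)
    (h : ∀ N : ℕ, ∃ C, ∀ x, (1 + ‖x‖) ^ N * ‖f x‖ ≤ C) (N : ℕ) :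
    Integrable (fun x => (1 + ‖x‖) ^ N * ‖f x‖) μ := by
  obtain ⟨C, hC⟩ := h (N + μ.integrablePower)
  refine ((Measure.integrable_pow_neg_integrablePower μ).const_mul C).mono' ?_
    (Filter.Eventually.of_forall fun x => ?_)
  · exact AEStronglyMeasurable.mul (by fun_prop) hf.norm
  · have hx : 0 < 1 + ‖x‖ := by positivity
    rw [Real.norm_of_nonneg (by positivity), Real.rpow_neg hx.le, Real.rpow_natCast,
      ← div_eq_mul_inv, le_div_iff₀ (by positivity)]
    have := hC x
    rw [pow_add] at this
    linarith

/-- The bound is by a continuous seminorm so that it can later yield continuity of operators and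
polynomial growth along `u ↦ π(u)ψ`. -/
theorem decay_schwartz (N : ℕ) : ∃ q : Seminorm ℂ 𝓢(Config d, ℂ), Continuous q ∧
    ∀ f t, (1 + ‖t‖) ^ N * ‖f t‖ ≤ q f := by
  let p : Seminorm ℂ 𝓢(Config d, ℂ) :=
    ∑ i ∈ Finset.Iic (N, 0), schwartzSeminormFamily ℂ (Config d) ℂ i
  have hp : Continuous p := by
    have : ⇑p = fun f => ∑ i ∈ Finset.Iic (N, 0), schwartzSeminormFamily ℂ (Config d) ℂ i f := by
      ext f
      simp [p]
    rw [this]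
    exact continuous_finsetSum _ fun i _ =>
      (schwartz_withSeminorms ℂ (Config d) ℂ).continuous_seminorm i
  refine ⟨(2 ^ N : ℝ≥0) • p, ?_, fun f t => ?_⟩
  · exact hp.const_smul (2 ^ N : ℝ≥0)
  · have h1 := one_add_le_sup_seminorm_apply (𝕜 := ℂ) (m := (N, 0)) (k := N) (n := 0)
      le_rfl le_rfl f t
    rw [norm_iteratedFDeriv_zero] at h1
    refine h1.trans ?_
    have h2 : (Finset.Iic (N, 0)).sup (schwartzSeminormFamily ℂ (Config d) ℂ) f ≤ p f :=
      Seminorm.finset_sup_le_sum _ _ f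
    change _ ≤ (2 ^ N : ℝ≥0) * p f
    push_cast
    gcongr
    exact h2

theorem integrable_weight_schwartz (g : 𝓢(Config d, ℂ)) (N : ℕ) :
    Integrable (fun t => (1 + ‖t‖) ^ N * ‖g t‖) := by
  refine integrable_of_decay g.continuous.aestronglyMeasurable (fun N => ?_) N
  obtain ⟨q, -, hq⟩ := decay_schwartz (d := d) N
  exact ⟨q g, hq g⟩

/-- In `f(t) · conj (g(t - z₁))` the two arguments cannot both be small: `1 + |z₁| ≤ (1 + |t|)(1 +
|t - z₁|)`. -/
theorem stftFun_decay_pos (g : 𝓢(Config d, ℂ)) (N : ℕ) :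
    ∃ q : Seminorm ℂ 𝓢(Config d, ℂ), Continuous q ∧
      ∀ (f : 𝓢(Config d, ℂ)) z, (1 + ‖pos z‖) ^ N * ‖stftFun g f z‖ ≤ q f := by
  obtain ⟨p, hp, hpf⟩ := decay_schwartz (d := d) N
  obtain ⟨B, hB⟩ : ∃ B : ℝ≥0, (B : ℝ) = ∫ t, (1 + ‖t‖) ^ N * ‖g t‖ :=
    ⟨⟨_, by positivity⟩, rfl⟩
  refine ⟨B • p, hp.const_smul B, fun f z => ?_⟩
  have hBp : (B • p) f = (∫ t, (1 + ‖t‖) ^ N * ‖g t‖) * p f := by rw [← hB]; rfl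
  rw [hBp]
  have hint := (integrable_weight_schwartz g N).comp_sub_right (pos z)
  have h1 : (1 + ‖pos z‖) ^ N * ‖stftFun g f z‖ =
      ‖∫ t, ((1 + ‖pos z‖) ^ N : ℝ) • (f t * conj (tfShift z g t))‖ := by
    rw [integral_smul, norm_smul, Real.norm_of_nonneg (by positivity), stftFun]
  rw [h1, ← integral_sub_right_eq_self (fun t => (1 + ‖t‖) ^ N * ‖g t‖) (pos z),
    ← integral_mul_const]
  refine norm_integral_le_of_norm_le (hint.mul_const _) (Filter.Eventually.of_forall fun t => ?_)
  rw [norm_smul, norm_mul, RCLike.norm_conj, norm_tfShift, Real.norm_of_nonneg (by positivity)]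
  calc (1 + ‖pos z‖) ^ N * (‖f t‖ * ‖g (t - pos z)‖)
      ≤ ((1 + ‖t‖) * (1 + ‖t - pos z‖)) ^ N * (‖f t‖ * ‖g (t - pos z)‖) := by
        gcongr
        exact one_add_norm_le_mul _ _
    _ = (1 + ‖t - pos z‖) ^ N * ‖g (t - pos z)‖ * ((1 + ‖t‖) ^ N * ‖f t‖) := by
        rw [mul_pow]; ring
    _ ≤ _ := by
        gcongr
        exact hpf f t

theorem fourier_tfShiftS (z : Phase d) (g : 𝓢(Config d, ℂ)) (ξ : Config d) :
    𝓕 (tfShiftS z g) ξ =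
      (Real.fourierChar (inner ℝ (pos z) (freq z)) : ℂ) *
        tfShift (phaseMk (freq z) (-pos z)) (𝓕 g : 𝓢(Config d, ℂ)) ξ := by
  rw [fourier_coe, Real.fourier_eq, ← integral_add_right_eq_self _ (pos z)]
  rw [tfShift, modFactor_eq_fourierChar, fourier_coe, Real.fourier_eq, ← mul_assoc,
    ← integral_const_mul]
  refine integral_congr_ae (Filter.Eventually.of_forall fun t => ?_)
  simp only [tfShiftS_apply, tfShift, modFactor_eq_fourierChar, Circle.smul_def, smul_eq_mul,
    add_sub_cancel_right, pos_phaseMk, freq_phaseMk]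
  simp only [← mul_assoc, ← Circle.coe_mul, ← AddChar.map_add_eq_mul]
  congr 3
  simp only [inner_add_left, inner_sub_right, inner_neg_right, real_inner_comm ξ (pos z)]
  ring

/-- By Parseval, the Fourier transform rotates phase space by `(z₁, z₂) ↦ (z₂, -z₁)` up to a phase.
This reduces decay in frequency to decay in position. -/
theorem norm_stftFun_fourier (g f : 𝓢(Config d, ℂ)) (z : Phase d) :
    ‖stftFun g f z‖ = ‖stftFun (𝓕 g : 𝓢(Config d, ℂ)) (𝓕 f : 𝓢(Config d, ℂ))
      (phaseMk (freq z) (-pos z))‖ := by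
  have h := integral_sesq_fourier_fourier (tfShiftS z g) f (innerSL ℂ (E := ℂ))
  simp only [innerSL_apply_apply, RCLike.inner_apply, fourier_tfShiftS, map_mul] at h
  have h1 : stftFun g f z = ∫ t, f t * conj (tfShiftS z g t) := by
    simp [stftFun, tfShiftS_apply]
  rw [h1, ← h]
  simp only [mul_left_comm, integral_const_mul, norm_mul]
  simp only [RCLike.norm_conj, Circle.norm_coe, one_mul, stftFun]

theorem stftFun_decay (g : 𝓢(Config d, ℂ)) (N : ℕ) :
    ∃ q : Seminorm ℂ 𝓢(Config d, ℂ), Continuous q ∧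
      ∀ (f : 𝓢(Config d, ℂ)) z, (1 + ‖z‖) ^ N * ‖stftFun g f z‖ ≤ q f := by
  -- The order is doubled because the position and frequency bounds are combined through `ab ≤ a² +
  -- b²`.
  obtain ⟨q₁, hq₁, h₁⟩ := stftFun_decay_pos g (2 * N)
  obtain ⟨q₂, hq₂, h₂⟩ := stftFun_decay_pos (𝓕 g) (2 * N)
  refine ⟨q₁ + q₂.comp (fourierTransformCLM ℂ (V := Config d) (E := ℂ)).toLinearMap, ?_,
    fun f z => ?_⟩
  · exact hq₁.add (hq₂.comp (fourierTransformCLM ℂ (V := Config d) (E := ℂ)).continuous)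
  · have h1 := h₁ f z
    have h2 := h₂ (𝓕 f) (phaseMk (freq z) (-pos z))
    rw [← norm_stftFun_fourier, pos_phaseMk] at h2
    change _ ≤ q₁ f + q₂ (𝓕 f)
    have h3 : (1 + ‖z‖) ^ N ≤ (1 + ‖pos z‖) ^ N * (1 + ‖freq z‖) ^ N := by
      rw [← mul_pow]
      gcongr
      exact one_add_norm_le_pos_freq z
    set a := (1 + ‖pos z‖) ^ N with ha
    set b := (1 + ‖freq z‖) ^ N with hb
    have ha2 : (1 + ‖pos z‖) ^ (2 * N) = a ^ 2 := by rw [mul_comm, pow_mul]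
    have hb2 : (1 + ‖freq z‖) ^ (2 * N) = b ^ 2 := by rw [mul_comm, pow_mul]
    rw [ha2] at h1
    rw [hb2] at h2
    have h4 : a * b ≤ a ^ 2 + b ^ 2 := by nlinarith [sq_nonneg (a - b), sq_nonneg (a + b)]
    calc _ ≤ (a ^ 2 + b ^ 2) * ‖stftFun g f z‖ := by gcongr; exact h3.trans h4
      _ ≤ _ := by linarith

theorem integrable_weight_stftFun (g f : 𝓢(Config d, ℂ)) (N : ℕ) :
    Integrable (fun z => (1 + ‖z‖) ^ N * ‖stftFun g f z‖) := by
  refine integrable_of_decay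
    (stronglyMeasurable_stftFun g.stronglyMeasurable f.stronglyMeasurable).aestronglyMeasurable
    (fun N => ?_) N
  obtain ⟨q, -, hq⟩ := stftFun_decay g N
  exact ⟨q f, hq f⟩

theorem integrable_stftFun (g f : 𝓢(Config d, ℂ)) : Integrable (stftFun g f) := by
  have h := integrable_weight_stftFun g f 0
  simp only [pow_zero, one_mul] at h
  exact (integrable_norm_iff (stronglyMeasurable_stftFun g.stronglyMeasurable
    f.stronglyMeasurable).aestronglyMeasurable).1 h

/-! ### Orthogonality relations -/

theorem _root_.MeasureTheory.Integrable.conj {α : Type*} [MeasurableSpace α] {μ : Measure α}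
    {f : α → ℂ} (hf : Integrable f μ) : Integrable (fun x => conj (f x)) μ :=
  (Complex.conjCLE : ℂ →L[ℝ] ℂ).integrable_comp hf

theorem tfShift_zero (f : Config d → ℂ) : tfShift 0 f = f := by
  funext t
  have h1 : pos (0 : Phase d) = 0 := rfl
  have h2 : freq (0 : Phase d) = 0 := rfl
  simp [tfShift, modFactor, h1, h2]

/-- A Parseval identity for `F` merely integrable, as a product of two `L²` functions is; Fourier
inversion is applied to `G` alone. -/
theorem integral_fourier_mul_conj_fourier {F : Config d → ℂ} (hF : Integrable F)
    (G : 𝓢(Config d, ℂ)) :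
    ∫ η, 𝓕 F η * conj (𝓕 (G : Config d → ℂ) η) = ∫ t, F t * conj (G t) := by
  have h := VectorFourier.integral_sesq_fourierIntegral_eq_neg_flip (innerSL ℂ (E := ℂ))
    (L := innerₗ (Config d)) Real.continuous_fourierChar continuous_inner hF
    ((𝓕 G : 𝓢(Config d, ℂ)).integrable (μ := volume))
  have h2 : ∫ η, 𝓕 (G : Config d → ℂ) η * conj (𝓕 F η) = ∫ t, G t * conj (F t) := by
    have h3 : ∀ x, VectorFourier.fourierIntegral Real.fourierChar volume
        (-(innerₗ (Config d)).flip) (𝓕 G : 𝓢(Config d, ℂ)) x = G x := fun x => by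
      have : (𝓕⁻ (𝓕 G : 𝓢(Config d, ℂ)) : 𝓢(Config d, ℂ)) x = G x := by simp
      rw [← this, fourierInv_coe]
      simp [Real.fourierInv_eq, VectorFourier.fourierIntegral, real_inner_comm]
    simp only [h3, innerSL_apply_apply, RCLike.inner_apply] at h
    exact h
  have h4 := congrArg conj h2
  rw [← integral_conj, ← integral_conj] at h4
  simpa only [map_mul, RCLike.conj_conj, mul_comm] using h4

theorem norm_integral_mul_conj_le {f g : Config d → ℂ} (hf : MemLp f 2) (hg : MemLp g 2)
    (z : Phase d) :
    Integrable (fun t => f t * conj (tfShift z g t)) ∧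
      ‖stftFun g f z‖ ≤ (∫ t, ‖f t‖ ^ 2) + ∫ t, ‖g t‖ ^ 2 := by
  have hg' := memLp_tfShift z hg
  have hf2 := (memLp_two_iff_integrable_sq_norm hf.1).1 hf
  have hg2 := (memLp_two_iff_integrable_sq_norm hg.1).1 hg
  have hg2' := hg2.comp_sub_right (pos z)
  have hb : ∀ t, ‖f t * conj (tfShift z g t)‖ ≤ ‖f t‖ ^ 2 + ‖g (t - pos z)‖ ^ 2 := fun t => by
    rw [norm_mul, RCLike.norm_conj, norm_tfShift]
    nlinarith [sq_nonneg (‖f t‖ - ‖g (t - pos z)‖), sq_nonneg (‖f t‖ + ‖g (t - pos z)‖)]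
  refine ⟨(hf2.add hg2').mono' ?_ (Filter.Eventually.of_forall hb), ?_⟩
  · exact hf.1.mul (Complex.continuous_conj.comp_aestronglyMeasurable hg'.1)
  · refine (norm_integral_le_of_norm_le (hf2.add hg2') (Filter.Eventually.of_forall hb)).trans ?_
    simp only [Pi.add_apply]
    rw [integral_add hf2 hg2', integral_sub_right_eq_self (fun t => ‖g t‖ ^ 2)]

/-- The orthogonality relations for the short-time Fourier transform. -/
theorem integral_stftFun_mul_conj {f₁ g₁ : Config d → ℂ} (hf : StronglyMeasurable f₁)
    (hg : StronglyMeasurable g₁) (hf2 : MemLp f₁ 2) (hg2 : MemLp g₁ 2) (f₂ g₂ : 𝓢(Config d, ℂ)) :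
    ∫ z, stftFun g₁ f₁ z * conj (stftFun g₂ f₂ z) =
      (∫ t, f₁ t * conj (f₂ t)) * conj (∫ t, g₁ t * conj (g₂ t)) := by
  -- At fixed position both factors are Fourier transforms in the frequency, so Parseval removes the
  -- frequency integral. What is left is a convolution integrand in `(t, x)`, which Fubini
  -- factorises.
  let Φ : Config d × Config d → ℂ := fun p =>
    𝓕 (fun t => f₁ t * conj (g₁ (t - p.1))) p.2 * conj (𝓕 (fun t => f₂ t * conj (g₂ (t - p.1))) p.2)
  have hΦ : ∀ z, stftFun g₁ f₁ z * conj (stftFun g₂ f₂ z) = Φ (phaseEquiv d z) := fun z => by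
    simp only [stftFun_eq_fourier, Φ, phaseEquiv_apply]
  -- The Schwartz pair supplies integrability; for the `L²` pair boundedness is enough.
  have hint : Integrable (fun z => stftFun g₁ f₁ z * conj (stftFun g₂ f₂ z)) := by
    refine Integrable.bdd_mul (c := (∫ t, ‖f₁ t‖ ^ 2) + ∫ t, ‖g₁ t‖ ^ 2) ?_
      (stronglyMeasurable_stftFun hg hf).aestronglyMeasurable
      (Filter.Eventually.of_forall fun z => (norm_integral_mul_conj_le hf2 hg2 z).2)
    exact (integrable_stftFun g₂ f₂).conj
  have hmp := measurePreserving_phaseEquiv d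
  have hintΦ : Integrable Φ := by
    rw [← hmp.integrable_comp_emb (phaseEquiv d).measurableEmbedding]
    exact hint.congr (Filter.Eventually.of_forall hΦ)
  simp only [hΦ]
  rw [hmp.integral_comp', Measure.volume_eq_prod, integral_prod _ (by exact hintΦ)]
  have hinner : ∀ x, ∫ η, Φ (x, η) =
      ∫ t, (f₁ t * conj (f₂ t)) * conj (g₁ (t - x) * conj (g₂ (t - x))) := fun x => by
    have hF : Integrable fun t => f₁ t * conj (g₁ (t - x)) := by
      simpa [tfShift, modFactor] using! (norm_integral_mul_conj_le hf2 hg2 (phaseMk x 0)).1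
    let G : 𝓢(Config d, ℂ) := pairing (ContinuousLinearMap.mul ℂ ℂ) f₂
      (conjS (compSubConstCLM ℂ x g₂))
    have hG : ∀ t, G t = f₂ t * conj (g₂ (t - x)) := fun t => by
      simp [G, conjS_apply]
    have := integral_fourier_mul_conj_fourier hF G
    have hG' : (G : Config d → ℂ) = fun t => f₂ t * conj (g₂ (t - x)) := funext hG
    rw [hG'] at this
    rw [this]
    refine integral_congr_ae (Filter.Eventually.of_forall fun t => ?_)
    simp only [map_mul, RCLike.conj_conj]
    ring
  simp only [hinner]
  have ha : Integrable fun t => f₁ t * conj (f₂ t) := by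
    simpa [tfShift_zero] using (norm_integral_mul_conj_le hf2 (f₂.memLp 2) 0).1
  have hb : Integrable fun t => conj (g₁ t * conj (g₂ t)) := by
    have : Integrable fun t => g₁ t * conj (g₂ t) := by
      simpa [tfShift_zero] using (norm_integral_mul_conj_le hg2 (g₂.memLp 2) 0).1
    exact this.conj
  rw [integral_integral_swap]
  · simp_rw [integral_const_mul]
    rw [← integral_conj, ← integral_mul_const]
    refine integral_congr_ae (Filter.Eventually.of_forall fun t => ?_)
    simp only
    rw [integral_sub_left_eq_self (fun s => conj (g₁ s * conj (g₂ s))) volume t]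
  · have := ha.convolution_integrand (ContinuousLinearMap.mul ℂ ℂ) hb.comp_neg
    simpa [Function.uncurry_def] using! this

/-! ### Superpositions of time-frequency shifts -/

theorem norm_iteratedFDeriv_modFactor_le (z : Phase d) (n : ℕ) (t : Config d) :
    ‖iteratedFDeriv ℝ n (modFactor z) t‖ ≤ (2 * Real.pi * ‖z‖) ^ n := by
  let L : Config d →L[ℝ] ℝ := (2 * Real.pi) • innerSL ℝ (freq z)
  have hL : modFactor z = (fun x : ℝ => Complex.exp (x * Complex.I)) ∘ L := by
    funext t
    simp [modFactor, L, real_inner_comm]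
  have hLn : ‖L‖ ≤ 2 * Real.pi * ‖z‖ := by
    simp only [L, norm_smul, innerSL_apply_norm]
    rw [Real.norm_of_nonneg (by positivity)]
    gcongr
    exact norm_freq_le z
  rw [hL, L.iteratedFDeriv_comp_right hasTemperateGrowth_expI.1 t (i := n)
    (by exact_mod_cast le_top)]
  refine (ContinuousMultilinearMap.norm_compContinuousLinearMap_le _ _).trans ?_
  rw [norm_iteratedFDeriv_eq_norm_iteratedDeriv, iteratedDeriv_expI]
  simp only [norm_mul, norm_pow, Complex.norm_I, one_pow, Complex.norm_exp_ofReal_mul_I, one_mul,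
    Finset.prod_const, Finset.card_univ, Fintype.card_fin]
  gcongr

/-- Translation costs `(1 + ‖z‖) ^ k` in the weight, and each derivative falling on the modulation
costs a factor `2π‖z‖`. -/
theorem seminorm_tfShiftS_le (g : 𝓢(Config d, ℂ)) (k n : ℕ) :
    ∃ C : ℝ, 0 ≤ C ∧ ∀ z t,
      ‖t‖ ^ k * ‖iteratedFDeriv ℝ n (tfShift z g) t‖ ≤ C * (1 + ‖z‖) ^ (k + n) := by
  let D : ℝ := 2 ^ k * (Finset.Iic (k, n)).sup (schwartzSeminormFamily ℝ (Config d) ℂ) g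
  refine ⟨∑ i ∈ Finset.range (n + 1), (n.choose i : ℝ) * (2 * Real.pi) ^ i * D,
    Finset.sum_nonneg fun i _ => by positivity, fun z t => ?_⟩
  have h1 := norm_iteratedFDeriv_mul_le (𝕜 := ℝ) (N := ∞) (f := modFactor z)
    (g := fun t => g (t - pos z)) (hasTemperateGrowth_modFactor z).1
    ((g.smooth ⊤).comp (by fun_prop)) t (n := n) (by exact_mod_cast le_top)
  have h2 : ‖t‖ ^ k ≤ (1 + ‖z‖) ^ k * (1 + ‖t - pos z‖) ^ k := by
    rw [← mul_pow]
    refine pow_le_pow_left₀ (norm_nonneg _) ?_ k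
    have h3 : ‖t‖ ≤ ‖pos z‖ + ‖t - pos z‖ := by
      simpa [add_comm] using norm_add_le (t - pos z) (pos z)
    nlinarith [norm_pos_le z, norm_nonneg z, norm_nonneg (t - pos z),
      mul_nonneg (norm_nonneg z) (norm_nonneg (t - pos z))]
  refine (mul_le_mul_of_nonneg_left h1 (by positivity)).trans ?_
  rw [Finset.mul_sum, Finset.sum_mul]
  refine Finset.sum_le_sum fun i hi => ?_
  have hi' : i ≤ n := Nat.lt_succ_iff.1 (Finset.mem_range.1 hi)
  have h4 := one_add_le_sup_seminorm_apply (𝕜 := ℝ) (m := (k, n)) (k := k) (n := n - i)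
      le_rfl (Nat.sub_le n i) g (t - pos z)
  rw [iteratedFDeriv_comp_sub]
  calc ‖t‖ ^ k * ((n.choose i : ℝ) * ‖iteratedFDeriv ℝ i (modFactor z) t‖ *
        ‖iteratedFDeriv ℝ (n - i) g (t - pos z)‖)
      ≤ ((1 + ‖z‖) ^ k * (1 + ‖t - pos z‖) ^ k) * ((n.choose i : ℝ) * (2 * Real.pi * ‖z‖) ^ i *
        ‖iteratedFDeriv ℝ (n - i) g (t - pos z)‖) := by
        gcongr
        exact norm_iteratedFDeriv_modFactor_le z i t
    _ = (n.choose i : ℝ) * (2 * Real.pi) ^ i * ((1 + ‖z‖) ^ k * ‖z‖ ^ i) *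
        ((1 + ‖t - pos z‖) ^ k * ‖iteratedFDeriv ℝ (n - i) g (t - pos z)‖) := by
        rw [mul_pow (2 * Real.pi)]; ring
    _ ≤ (n.choose i : ℝ) * (2 * Real.pi) ^ i * (1 + ‖z‖) ^ (k + n) * D := by
        have h5 : (1 + ‖z‖) ^ k * ‖z‖ ^ i ≤ (1 + ‖z‖) ^ (k + n) := by
          rw [pow_add]
          gcongr
          calc ‖z‖ ^ i ≤ (1 + ‖z‖) ^ i := by gcongr; linarith [norm_nonneg z]
            _ ≤ (1 + ‖z‖) ^ n := pow_le_pow_right₀ (by linarith [norm_nonneg z]) hi'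
        gcongr
        exact h4
    _ = _ := by ring

theorem contDiff_pos : ContDiff ℝ ∞ (pos : Phase d → Config d) :=
  (LinearMap.toContinuousLinearMap (E := Phase d) (F' := Config d)
    { toFun := pos, map_add' := fun _ _ => rfl, map_smul' := fun _ _ => rfl } :
    Phase d →L[ℝ] Config d).contDiff

theorem contDiff_freq : ContDiff ℝ ∞ (freq : Phase d → Config d) :=
  (LinearMap.toContinuousLinearMap (E := Phase d) (F' := Config d)
    { toFun := freq, map_add' := fun _ _ => rfl, map_smul' := fun _ _ => rfl } :
    Phase d →L[ℝ] Config d).contDiff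

theorem contDiff_tfShift_uncurry (g : 𝓢(Config d, ℂ)) :
    ContDiff ℝ ∞ (fun p : Phase d × Config d => tfShift p.1 g p.2) := by
  have h1 : ContDiff ℝ ∞ fun p : Phase d × Config d => p.2 - pos p.1 :=
    contDiff_snd.sub (contDiff_pos.comp contDiff_fst)
  have h2 : ContDiff ℝ ∞ fun p : Phase d × Config d => 2 * Real.pi * inner ℝ p.2 (freq p.1) :=
    contDiff_const.mul (contDiff_snd.inner ℝ (contDiff_freq.comp contDiff_fst))
  have h3 : ContDiff ℝ ∞ fun p : Phase d × Config d => modFactor p.1 p.2 := by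
    unfold modFactor
    exact hasTemperateGrowth_expI.1.comp h2
  have h4 : ContDiff ℝ ∞ fun p : Phase d × Config d => g (p.2 - pos p.1) := (g.smooth ⊤).comp h1
  unfold tfShift
  exact h3.mul h4

theorem contDiff_tfShift (g : 𝓢(Config d, ℂ)) (z : Phase d) : ContDiff ℝ ∞ (tfShift z g) :=
  ContDiff.comp (g := fun p : Phase d × Config d => tfShift p.1 g p.2) (f := fun t => (z, t))
    (contDiff_tfShift_uncurry g) (contDiff_prodMk_right z)

/-- Derivatives in `t` are restrictions of the joint derivatives in `(z, t)`, which are continuous.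
This gives measurability in `z` of the integrands below. -/
theorem continuous_iteratedFDeriv_tfShift (g : 𝓢(Config d, ℂ)) (n : ℕ) (t : Config d) :
    Continuous fun z : Phase d => iteratedFDeriv ℝ n (tfShift z g) t := by
  let G : Phase d × Config d → ℂ := fun p => tfShift p.1 g p.2
  have hG : ContDiff ℝ ∞ G := contDiff_tfShift_uncurry g
  have h : ∀ z : Phase d, iteratedFDeriv ℝ n (tfShift z g) t =
      (iteratedFDeriv ℝ n G (z, t)).compContinuousLinearMap
        fun _ => ContinuousLinearMap.inr ℝ (Phase d) (Config d) := fun z => by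
    have h1 : tfShift z g = (fun p => G ((z, 0) + p)) ∘
        ContinuousLinearMap.inr ℝ (Phase d) (Config d) := by
      funext s
      simp [G]
    have h2 : ContDiff ℝ ∞ fun p => G ((z, 0) + p) := hG.comp (contDiff_const.add contDiff_id)
    rw [h1, ContinuousLinearMap.iteratedFDeriv_comp_right _ h2 _ (by exact_mod_cast le_top),
      iteratedFDeriv_comp_add_left]
    simp
  simp only [h]
  have h2 : Continuous fun z : Phase d => iteratedFDeriv ℝ n G (z, t) :=
    (hG.continuous_iteratedFDeriv (by exact_mod_cast le_top)).comp (by fun_prop)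
  exact (ContinuousMultilinearMap.compContinuousLinearMapL (𝕜 := ℝ)
    (fun _ : Fin n => ContinuousLinearMap.inr ℝ (Phase d) (Config d))).continuous.comp h2

theorem integrable_smul_iteratedFDeriv_tfShift (g : 𝓢(Config d, ℂ)) {F : Phase d → ℂ}
    (hF : AEStronglyMeasurable F) (hFi : ∀ N : ℕ, Integrable fun z => (1 + ‖z‖) ^ N * ‖F z‖)
    (n : ℕ) (t : Config d) :
    Integrable fun z => F z • iteratedFDeriv ℝ n (tfShift z g) t := by
  obtain ⟨C, hC, h⟩ := seminorm_tfShiftS_le g 0 n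
  refine ((hFi (0 + n)).const_mul C).mono'
    (hF.smul (continuous_iteratedFDeriv_tfShift g n t).aestronglyMeasurable)
    (Filter.Eventually.of_forall fun z => ?_)
  have := h z t
  rw [pow_zero, one_mul] at this
  rw [norm_smul]
  nlinarith [norm_nonneg (F z)]

theorem norm_integral_smul_iteratedFDeriv_tfShift_le (g : 𝓢(Config d, ℂ)) (k n : ℕ) :
    ∃ C : ℝ, 0 ≤ C ∧ ∀ F : Phase d → ℂ,
      Integrable (fun z => (1 + ‖z‖) ^ (k + n) * ‖F z‖) → ∀ t,
      ‖t‖ ^ k * ‖∫ z, F z • iteratedFDeriv ℝ n (tfShift z g) t‖ ≤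
        C * ∫ z, (1 + ‖z‖) ^ (k + n) * ‖F z‖ := by
  obtain ⟨C, hC, h⟩ := seminorm_tfShiftS_le g k n
  refine ⟨C, hC, fun F hF t => ?_⟩
  have h1 : ‖t‖ ^ k * ‖∫ z, F z • iteratedFDeriv ℝ n (tfShift z g) t‖ =
      ‖∫ z, (‖t‖ ^ k : ℝ) • (F z • iteratedFDeriv ℝ n (tfShift z g) t)‖ := by
    rw [integral_smul, norm_smul, Real.norm_of_nonneg (by positivity)]
  rw [h1, ← integral_const_mul]
  refine norm_integral_le_of_norm_le (hF.const_mul C) (Filter.Eventually.of_forall fun z => ?_)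
  rw [norm_smul, norm_smul, Real.norm_of_nonneg (by positivity)]
  nlinarith [mul_le_mul_of_nonneg_left (h z t) (norm_nonneg (F z))]

/-- Currying the first variable of a multilinear map, as a continuous linear map. -/
def curryLeftCLM (E F : Type*) [NormedAddCommGroup E] [NormedSpace ℝ E] [NormedAddCommGroup F]
    [NormedSpace ℝ F] (n : ℕ) : (E [×n + 1]→L[ℝ] F) →L[ℝ] (E →L[ℝ] E [×n]→L[ℝ] F) :=
  (continuousMultilinearCurryLeftEquiv ℝ (fun _ : Fin (n + 1) => E)
    F).toLinearIsometry.toContinuousLinearMap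

theorem curryLeftCLM_apply {E F : Type*} [NormedAddCommGroup E] [NormedSpace ℝ E]
    [NormedAddCommGroup F] [NormedSpace ℝ F] {n : ℕ} (f : E [×n + 1]→L[ℝ] F) :
    curryLeftCLM E F n f = f.curryLeft := rfl

theorem norm_curryLeftCLM_apply {E F : Type*} [NormedAddCommGroup E] [NormedSpace ℝ E]
    [NormedAddCommGroup F] [NormedSpace ℝ F] {n : ℕ} (f : E [×n + 1]→L[ℝ] F) :
    ‖curryLeftCLM E F n f‖ = ‖f‖ :=
  (continuousMultilinearCurryLeftEquiv ℝ (fun _ : Fin (n + 1) => E) F).norm_map f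

theorem integral_curryLeftCLM {α E F : Type*} [MeasurableSpace α] {μ : Measure α}
    [NormedAddCommGroup E] [NormedSpace ℝ E]
    [NormedAddCommGroup F] [NormedSpace ℝ F] [CompleteSpace F] {n : ℕ}
    {f : α → E [×n + 1]→L[ℝ] F} (hf : Integrable f μ) :
    ∫ a, curryLeftCLM E F n (f a) ∂μ = (∫ a, f a ∂μ).curryLeft := by
  rw [← curryLeftCLM_apply]
  exact ContinuousLinearMap.integral_comp_comm (𝕜 := ℝ) (Fₗ := E →L[ℝ] E [×n]→L[ℝ] F) _ hf

theorem hasFDerivAt_smul_iteratedFDeriv {E : Type*} [NormedAddCommGroup E] [NormedSpace ℝ E]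
    {f : E → ℂ} (hf : ContDiff ℝ ∞ f) (c : ℂ) (n : ℕ) (x : E) :
    HasFDerivAt (fun t => c • iteratedFDeriv ℝ n f t)
      (curryLeftCLM E ℂ n (c • iteratedFDeriv ℝ (n + 1) f x)) x := by
  have h1 := (hf.differentiable_iteratedFDeriv (m := n)
    (by exact_mod_cast ENat.natCast_lt_top n) x).hasFDerivAt
  exact h1.const_smul c

theorem hasFDerivAt_integral_smul_iteratedFDeriv_tfShift (g : 𝓢(Config d, ℂ)) {F : Phase d → ℂ}
    (hF : AEStronglyMeasurable F) (hFi : ∀ N : ℕ, Integrable fun z => (1 + ‖z‖) ^ N * ‖F z‖)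
    (n : ℕ) (t : Config d) :
    HasFDerivAt (fun t => ∫ z, F z • iteratedFDeriv ℝ n (tfShift z g) t)
      (∫ z, F z • iteratedFDeriv ℝ (n + 1) (tfShift z g) t).curryLeft t := by
  obtain ⟨C, hC, h⟩ := seminorm_tfShiftS_le g 0 (n + 1)
  have hint := integrable_smul_iteratedFDeriv_tfShift g hF hFi (n + 1) t
  have hmeas := (curryLeftCLM (Config d) ℂ n).continuous.comp_aestronglyMeasurable hint.1
  have hbd : ∀ z x, ‖curryLeftCLM (Config d) ℂ n (F z • iteratedFDeriv ℝ (n + 1) (tfShift z g) x)‖ ≤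
      C * ((1 + ‖z‖) ^ (0 + (n + 1)) * ‖F z‖) := fun z x => by
    have := h z x
    rw [pow_zero, one_mul] at this
    rw [norm_curryLeftCLM_apply, norm_smul]
    nlinarith [norm_nonneg (F z)]
  rw [← integral_curryLeftCLM hint]
  exact hasFDerivAt_integral_of_dominated_of_fderiv_le (𝕜 := ℝ) (s := Set.univ)
    (F := fun x z => F z • iteratedFDeriv ℝ n (tfShift z g) x)
    (F' := fun x z => curryLeftCLM (Config d) ℂ n (F z • iteratedFDeriv ℝ (n + 1) (tfShift z g) x))
    Filter.univ_mem
    (Filter.Eventually.of_forall fun x =>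
      (integrable_smul_iteratedFDeriv_tfShift g hF hFi n x).1)
    (integrable_smul_iteratedFDeriv_tfShift g hF hFi n t) hmeas
    (Filter.Eventually.of_forall fun z x _ => hbd z x) ((hFi _).const_mul C)
    (Filter.Eventually.of_forall fun z x _ =>
      hasFDerivAt_smul_iteratedFDeriv (contDiff_tfShift g z) (F z) n x)

/-- Superposition of time-frequency shifts of a Schwartz function with rapidly decaying
coefficients. -/
theorem exists_schwartz_superposition (g : 𝓢(Config d, ℂ)) {F : Phase d → ℂ}
    (hF : AEStronglyMeasurable F) (hFi : ∀ N : ℕ, Integrable fun z => (1 + ‖z‖) ^ N * ‖F z‖) :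
    ∃ Φ : 𝓢(Config d, ℂ), (∀ t, Φ t = ∫ z, F z * tfShift z g t) ∧
      ∀ t n, iteratedFDeriv ℝ n Φ t = ∫ z, F z • iteratedFDeriv ℝ n (tfShift z g) t := by
  let p : Config d → FormalMultilinearSeries ℝ (Config d) ℂ := fun t n =>
    ∫ z, F z • iteratedFDeriv ℝ n (tfShift z g) t
  have hder : ∀ n t, HasFDerivAt (fun t => p t n) (p t n.succ).curryLeft t := fun n t =>
    hasFDerivAt_integral_smul_iteratedFDeriv_tfShift g hF hFi n t
  -- Displaying all formal derivatives as one Taylor series gives smoothness and identifies every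
  -- iterated derivative at once.
  have htaylor : HasFTaylorSeriesUpTo ∞ (fun t => ∫ z, F z * tfShift z g t) p := by
    refine ⟨fun t => ?_, fun n _ t => hder n t, fun n _ => ?_⟩
    · have := (ContinuousMultilinearMap.apply ℝ (fun _ : Fin 0 => Config d) ℂ 0).integral_comp_comm
        (integrable_smul_iteratedFDeriv_tfShift g hF hFi 0 t)
      refine this.symm.trans (integral_congr_ae (Filter.Eventually.of_forall fun z => ?_))
      simp
    · exact continuous_iff_continuousAt.2 fun t => (hder n t).continuousAt
  have hp : ∀ t n, p t n = iteratedFDeriv ℝ n (fun t => ∫ z, F z * tfShift z g t) t := fun t n =>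
    htaylor.eq_iteratedFDeriv (by exact_mod_cast le_top) t
  refine ⟨⟨_, htaylor.contDiff, fun k n => ?_⟩, fun t => rfl, fun t n => (hp t n).symm⟩
  obtain ⟨C, hC, h⟩ := norm_integral_smul_iteratedFDeriv_tfShift_le g k n
  refine ⟨C * ∫ z, (1 + ‖z‖) ^ (k + n) * ‖F z‖, fun t => ?_⟩
  rw [← hp]
  exact h F (hFi _) t

/-! ### Reconstruction from the transform -/

theorem ae_eq_of_integral_mul_conj_schwartz {f g : Config d → ℂ} (hf : MemLp f 2)
    (hg : MemLp g 2)
    (h : ∀ ψ : 𝓢(Config d, ℂ), ∫ t, f t * conj (ψ t) = ∫ t, g t * conj (ψ t)) : f =ᵐ[volume] g := by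
  have hinj : Function.Injective (Lp.toTemperedDistributionCLM ℂ (volume : Measure (Config d)) 2) :=
    LinearMap.ker_eq_bot.1 Lp.ker_toTemperedDistributionCLM_eq_bot
  have key : ∀ (f : Config d → ℂ) (hf : MemLp f 2) (ψ : 𝓢(Config d, ℂ)),
      Lp.toTemperedDistribution (hf.toLp f) ψ = ∫ t, f t * conj (conjS ψ t) := fun f hf ψ => by
    rw [Lp.toTemperedDistribution_apply]
    refine integral_congr_ae ?_
    filter_upwards [hf.coeFn_toLp] with t ht
    rw [ht, conjS_apply, Complex.conj_conj, smul_eq_mul, mul_comm]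
  have : hf.toLp f = hg.toLp g := by
    apply hinj
    ext ψ
    simp only [Lp.toTemperedDistributionCLM_apply, key, h]
  exact (MemLp.toLp_eq_toLp_iff hf hg).1 this

theorem integral_mul_conj_self_ne_zero {φ : 𝓢(Config d, ℂ)} (hφ : φ ≠ 0) :
    ∫ t, φ t * conj (φ t) ≠ 0 := by
  intro h
  apply hφ
  have h1 : inner ℂ (φ.toLp 2 volume) (φ.toLp 2 volume) = 0 := by
    rw [inner_toL2_toL2_eq φ φ volume, ← h]
    simp only [RCLike.inner_apply]
  rw [inner_self_eq_zero] at h1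
  apply injective_toLp 2 volume
  simp only [h1]
  exact (map_zero (toLpCLM ℂ ℂ 2 volume)).symm

theorem integral_superposition_swap (φ ψ : 𝓢(Config d, ℂ)) {F : Phase d → ℂ}
    (hFm : StronglyMeasurable F) (hFint : Integrable F) :
    ∫ t, ∫ z, F z * tfShift z φ t * conj (ψ t) = ∫ z, ∫ t, F z * tfShift z φ t * conj (ψ t) := by
  obtain ⟨q, -, hq⟩ := decay_schwartz (d := d) 0
  have h1 : StronglyMeasurable fun p : Config d × Phase d => F p.2 :=
    hFm.comp_measurable measurable_snd
  have h2 : StronglyMeasurable fun p : Config d × Phase d => tfShift p.2 φ p.1 :=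
    (stronglyMeasurable_tfShift φ.stronglyMeasurable).comp_measurable
      (g := fun p : Config d × Phase d => (p.2, p.1)) measurable_swap
  have h3 : StronglyMeasurable fun p : Config d × Phase d => conj (ψ p.1) :=
    (Complex.continuous_conj.comp (ψ.continuous.comp continuous_fst)).stronglyMeasurable
  have hprod : Integrable (fun p : Config d × Phase d => ‖ψ p.1‖ * ‖F p.2‖)
      (volume.prod volume) := (ψ.integrable (μ := volume)).norm.mul_prod hFint.norm
  have h4 : ∀ p : Config d × Phase d, ‖F p.2 * tfShift p.2 φ p.1 * conj (ψ p.1)‖ ≤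
      q φ * (‖ψ p.1‖ * ‖F p.2‖) := fun p => by
    have h5 := hq φ (p.1 - pos p.2)
    rw [pow_zero, one_mul] at h5
    rw [norm_mul, norm_mul, RCLike.norm_conj, norm_tfShift]
    calc ‖F p.2‖ * ‖φ (p.1 - pos p.2)‖ * ‖ψ p.1‖ ≤ ‖F p.2‖ * q φ * ‖ψ p.1‖ := by gcongr
      _ = _ := by ring
  have hI : Integrable (fun p : Config d × Phase d => F p.2 * tfShift p.2 φ p.1 * conj (ψ p.1))
      (volume.prod volume) :=
    (hprod.const_mul (q φ)).mono' ((h1.mul h2).mul h3).aestronglyMeasurable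
      (Filter.Eventually.of_forall h4)
  exact integral_integral_swap hI

/-- Reconstruction of a square integrable function from a rapidly decaying short-time Fourier
transform. -/
theorem exists_schwartz_of_stftFun {φ : 𝓢(Config d, ℂ)} (hφ : φ ≠ 0) {f : Config d → ℂ}
    (hf : StronglyMeasurable f) (hf2 : MemLp f 2)
    (hdec : ∀ N : ℕ, Integrable fun z => (1 + ‖z‖) ^ N * ‖stftFun φ f z‖) :
    ∃ Φ : 𝓢(Config d, ℂ), f =ᵐ[volume] Φ ∧ ∀ t n, iteratedFDeriv ℝ n Φ t =
      ∫ z, ((conj (∫ t, φ t * conj (φ t)))⁻¹ * stftFun φ f z) •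
        iteratedFDeriv ℝ n (tfShift z φ) t := by
  set a : ℂ := conj (∫ t, φ t * conj (φ t)) with ha
  have ha0 : a ≠ 0 := (map_ne_zero _).2 (integral_mul_conj_self_ne_zero hφ)
  let F : Phase d → ℂ := fun z => a⁻¹ * stftFun φ f z
  have hFm : StronglyMeasurable F :=
    (stronglyMeasurable_stftFun φ.stronglyMeasurable hf).const_mul _
  have hFi : ∀ N : ℕ, Integrable fun z => (1 + ‖z‖) ^ N * ‖F z‖ := fun N => by
    refine ((hdec N).const_mul ‖a⁻¹‖).congr (Filter.Eventually.of_forall fun z => ?_)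
    simp only [F, norm_mul]
    ring
  obtain ⟨Φ, hΦ, hΦd⟩ := exists_schwartz_superposition φ hFm.aestronglyMeasurable hFi
  refine ⟨Φ, ae_eq_of_integral_mul_conj_schwartz hf2 (Φ.memLp 2) fun ψ => ?_, hΦd⟩
  have hFint : Integrable F := by
    have := hFi 0
    simp only [pow_zero, one_mul] at this
    exact (integrable_norm_iff hFm.aestronglyMeasurable).1 this
  -- Tested against `ψ`, the superposition becomes the pairing of `V_φ f` with `V_φ ψ`;
  -- orthogonality turns this into `⟨f, ψ⟩`, the factor `a⁻¹` cancelling `‖φ‖₂²`.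
  have hmoyal := integral_stftFun_mul_conj hf φ.stronglyMeasurable hf2 (φ.memLp 2) ψ φ
  have hswap := integral_superposition_swap φ ψ hFm hFint
  have hR : ∫ t, Φ t * conj (ψ t) = ∫ z, a⁻¹ * (stftFun φ f z * conj (stftFun φ ψ z)) := by
    have h1 : ∀ t, Φ t * conj (ψ t) = ∫ z, F z * tfShift z φ t * conj (ψ t) := fun t => by
      rw [hΦ, integral_mul_const]
    simp only [h1]
    rw [hswap]
    refine integral_congr_ae (Filter.Eventually.of_forall fun z => ?_)
    have h2 : ∫ t, tfShift z φ t * conj (ψ t) = conj (stftFun φ ψ z) := by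
      rw [stftFun, ← integral_conj]
      simp only [map_mul, Complex.conj_conj, mul_comm]
    simp only [mul_assoc, integral_const_mul, h2, F]
  rw [hR, integral_const_mul, hmoyal, ← ha]
  field_simp

/-- Reconstruct `f` from its transform and differentiate under the integral; `π(z)φ` has seminorms
of order `(1 + ‖z‖) ^ (k + n)`. -/
theorem seminorm_le_integral_stftFun {φ : 𝓢(Config d, ℂ)} (hφ : φ ≠ 0) (k n : ℕ) :
    ∃ C : ℝ, 0 ≤ C ∧ ∀ f : 𝓢(Config d, ℂ),
      SchwartzMap.seminorm ℂ k n f ≤ C * ∫ z, (1 + ‖z‖) ^ (k + n) * ‖stftFun φ f z‖ := by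
  obtain ⟨C, hC, h⟩ := norm_integral_smul_iteratedFDeriv_tfShift_le φ k n
  set a : ℂ := conj (∫ t, φ t * conj (φ t)) with ha
  refine ⟨C * ‖a⁻¹‖, by positivity, fun f => ?_⟩
  obtain ⟨Φ, hfΦ, hΦ⟩ := exists_schwartz_of_stftFun hφ f.stronglyMeasurable (f.memLp 2)
    (integrable_weight_stftFun φ f)
  have hfe : f = Φ := by
    apply DFunLike.coe_injective
    exact (Continuous.ae_eq_iff_eq volume f.continuous Φ.continuous).1 hfΦ
  have heq : ∫ z, (1 + ‖z‖) ^ (k + n) * ‖a⁻¹ * stftFun φ f z‖ =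
      ‖a⁻¹‖ * ∫ z, (1 + ‖z‖) ^ (k + n) * ‖stftFun φ f z‖ := by
    rw [← integral_const_mul]
    refine integral_congr_ae (Filter.Eventually.of_forall fun z => ?_)
    simp only [norm_mul]
    ring
  refine seminorm_le_bound ℂ k n f (by positivity) fun t => ?_
  have hint : Integrable (fun z => (1 + ‖z‖) ^ (k + n) * ‖a⁻¹ * stftFun φ f z‖) := by
    refine ((integrable_weight_stftFun φ f (k + n)).const_mul ‖a⁻¹‖).congr
      (Filter.Eventually.of_forall fun z => ?_)
    simp only [norm_mul]
    ring
  have h1 := h _ hint t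
  rw [heq, ← hΦ, ← hfe] at h1
  linarith

/-! ### From the ambiguity function to Schwartz windows -/

theorem seminorm_tfShiftS_growth {q : Seminorm ℂ 𝓢(Config d, ℂ)} (hq : Continuous q)
    (ψ : 𝓢(Config d, ℂ)) :
    ∃ (C : ℝ) (M : ℕ), 0 ≤ C ∧ ∀ u, q (tfShiftS u ψ) ≤ C * (1 + ‖u‖) ^ M := by
  obtain ⟨s, C, -, hqs⟩ := Seminorm.bound_of_continuous (schwartz_withSeminorms ℂ (Config d) ℂ) q hq
  have hsem : ∀ i : ℕ × ℕ, ∃ C : ℝ, 0 ≤ C ∧ ∀ u, schwartzSeminormFamily ℂ (Config d) ℂ i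
      (tfShiftS u ψ) ≤ C * (1 + ‖u‖) ^ (i.1 + i.2) := fun i => by
    obtain ⟨C, hC, h⟩ := seminorm_tfShiftS_le ψ i.1 i.2
    refine ⟨C, hC, fun u => seminorm_le_bound ℂ i.1 i.2 _ (by positivity) fun t => ?_⟩
    have : (tfShiftS u ψ : Config d → ℂ) = tfShift u ψ := funext (tfShiftS_apply u ψ)
    rw [this]
    exact h u t
  choose D hD hDs using hsem
  refine ⟨C * ∑ i ∈ s, D i, ∑ i ∈ s, (i.1 + i.2), mul_nonneg C.2 (Finset.sum_nonneg fun i _ => hD i), fun u => ?_⟩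
  calc q (tfShiftS u ψ) ≤ C * (s.sup (schwartzSeminormFamily ℂ (Config d) ℂ)) (tfShiftS u ψ) :=
        hqs _
    _ ≤ C * ((∑ i ∈ s, D i) * (1 + ‖u‖) ^ (∑ i ∈ s, (i.1 + i.2))) := by
        gcongr
        refine (Seminorm.finset_sup_le_sum _ s _).trans ?_
        rw [_root_.sum_apply, Finset.sum_mul]
        refine Finset.sum_le_sum fun i hi => (hDs i u).trans ?_
        have := hD i
        gcongr
        · linarith [norm_nonneg u]
        · exact Finset.single_le_sum (f := fun i : ℕ × ℕ => i.1 + i.2) (fun _ _ => Nat.zero_le _) hi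
    _ = _ := by ring

theorem norm_stftFun_swap (φ ψ : 𝓢(Config d, ℂ)) (z u : Phase d) :
    ‖stftFun ψ (tfShiftS z φ) u‖ = ‖stftFun φ (tfShiftS u ψ) z‖ := by
  rw [← RCLike.norm_conj, stftFun, stftFun, ← integral_conj]
  congr 1
  refine integral_congr_ae (Filter.Eventually.of_forall fun t => ?_)
  simp only [map_mul, Complex.conj_conj, tfShiftS_apply, mul_comm]

theorem norm_stftFun_tfShiftS_le (φ ψ : 𝓢(Config d, ℂ)) (N : ℕ) :
    ∃ (C : ℝ) (M : ℕ), 0 ≤ C ∧ ∀ z u,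
      (1 + ‖u‖) ^ N * ‖stftFun ψ (tfShiftS z φ) u‖ ≤ C * (1 + ‖z‖) ^ M := by
  obtain ⟨q, hq, h⟩ := stftFun_decay ψ N
  obtain ⟨C, M, hC, hg⟩ := seminorm_tfShiftS_growth hq φ
  exact ⟨C, M, hC, fun z u => (h _ u).trans (hg z)⟩

/-- A square integrable function whose ambiguity function decays rapidly has a rapidly decaying
short-time Fourier transform with respect to every Schwartz window. -/
theorem stftFun_decay_of_ambiguity {f : Config d → ℂ} (hf : StronglyMeasurable f)
    (hf2 : MemLp f 2) (hf0 : ¬ f =ᵐ[volume] 0)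
    (hdec : ∀ N : ℕ, Integrable fun u => (1 + ‖u‖) ^ N * ‖stftFun f f u‖)
    {φ : 𝓢(Config d, ℂ)} (hφ : φ ≠ 0) (N : ℕ) :
    ∃ C, ∀ z, (1 + ‖z‖) ^ N * ‖stftFun φ f z‖ ≤ C := by
  -- If `V_φ f` vanished identically, orthogonality would make `f` orthogonal to every Schwartz
  -- function.
  obtain ⟨w, hw⟩ : ∃ w, stftFun φ f w ≠ 0 := by
    by_contra! hcon
    refine hf0 (ae_eq_of_integral_mul_conj_schwartz hf2 MemLp.zero fun ψ => ?_)
    have h := integral_stftFun_mul_conj hf φ.stronglyMeasurable hf2 (φ.memLp 2) ψ φ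
    simp only [hcon, zero_mul, integral_zero] at h
    have h2 := (map_ne_zero (starRingEnd ℂ)).2 (integral_mul_conj_self_ne_zero hφ)
    simpa [h2] using h.symm
  obtain ⟨C, M, hC, hbd⟩ := norm_stftFun_tfShiftS_le (tfShiftS w φ) φ N
  have hw' : 0 < ‖stftFun φ f w‖ := norm_pos_iff.2 hw
  refine ⟨(C * ∫ u, (1 + ‖u‖) ^ M * ‖stftFun f f u‖) / ‖stftFun φ f w‖, fun z => ?_⟩
  rw [le_div_iff₀ hw', mul_assoc]
  have hcoe : ∀ z : Phase d, ∫ t, f t * conj (tfShiftS z φ t) = stftFun φ f z := fun z => by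
    simp [stftFun, tfShiftS_apply]
  -- The right side is `V_φ f(z) · conj (V_φ f(w))`. On the left, the factor paired with `V_f f(u)`
  -- decays in `z` at a cost polynomial in `u`, which the decay of `V_f f` absorbs.
  have h := integral_stftFun_mul_conj hf hf hf2 hf2 (tfShiftS z φ) (tfShiftS w φ)
  rw [hcoe, hcoe] at h
  have h1 : (1 + ‖z‖) ^ N * (‖stftFun φ f z‖ * ‖stftFun φ f w‖) =
      ‖∫ u, ((1 + ‖z‖) ^ N : ℝ) • (stftFun f f u *
        conj (stftFun (tfShiftS w φ) (tfShiftS z φ) u))‖ := by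
    rw [integral_smul, norm_smul, h, norm_mul, RCLike.norm_conj,
      Real.norm_of_nonneg (by positivity)]
  rw [h1, ← integral_const_mul]
  refine norm_integral_le_of_norm_le ((hdec M).const_mul C) (Filter.Eventually.of_forall fun u => ?_)
  rw [norm_smul, norm_mul, RCLike.norm_conj, Real.norm_of_nonneg (by positivity), norm_stftFun_swap]
  nlinarith [mul_le_mul_of_nonneg_left (hbd u z) (norm_nonneg (stftFun f f u))]

/-! ### Intertwining isometries preserve the Schwartz space -/

theorem stftFun_congr_ae {f f' g g' : Config d → ℂ} (hf : f =ᵐ[volume] f') (hg : g =ᵐ[volume] g')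
    (z : Phase d) : stftFun g f z = stftFun g' f' z := by
  have hg2 : ∀ᵐ t, g (t - pos z) = g' (t - pos z) :=
    (measurePreserving_sub_right volume (pos z)).quasiMeasurePreserving.ae hg
  refine integral_congr_ae ?_
  filter_upwards [hf, hg2] with t h1 h2
  simp only [tfShift, h1, h2]

theorem stftFun_eq_inner (g f : L2 d) (z : Phase d) :
    stftFun g f z = inner ℂ (tfShiftL2 z g) f := by
  rw [L2.inner_def, stftFun]
  refine integral_congr_ae ?_
  filter_upwards [(memLp_tfShift z (Lp.memLp g)).coeFn_toLp] with t ht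
  rw [tfShiftL2, ht, RCLike.inner_apply]

theorem stftFun_schwartz_eq (φ f : 𝓢(Config d, ℂ)) (z : Phase d) :
    stftFun φ f z = stftFun (φ.toLp 2 volume : L2 d) (f.toLp 2 volume : L2 d) z :=
  stftFun_congr_ae (f.coeFn_toLp 2 volume).symm (φ.coeFn_toLp 2 volume).symm z

/-- The isometry `W` of `L²` intertwines time-frequency shifts, up to phase factors, along the
map `B` of phase space. -/
def Intertwines (W : L2 d ≃ₗᵢ[ℂ] L2 d) (B : Phase d → Phase d) : Prop :=
  ∀ z, ∃ c : ℂ, ‖c‖ = 1 ∧ ∀ f, W (tfShiftL2 z f) = c • tfShiftL2 (B z) (W f)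

theorem Intertwines.norm_stftFun {W : L2 d ≃ₗᵢ[ℂ] L2 d} {B : Phase d → Phase d}
    (h : Intertwines W B) (g f : L2 d) (z : Phase d) :
    ‖stftFun (W g) (W f) (B z)‖ = ‖stftFun g f z‖ := by
  obtain ⟨c, hc, hW⟩ := h z
  rw [stftFun_eq_inner, stftFun_eq_inner, ← W.inner_map_map (tfShiftL2 z g) f, hW, inner_smul_left, norm_mul,
    RCLike.norm_conj, hc, one_mul]

theorem one_add_norm_pow_le_symm (B : Phase d ≃L[ℝ] Phase d) :
    ∃ β : ℝ, 0 ≤ β ∧ ∀ (N : ℕ) u, (1 + ‖u‖) ^ N ≤ β ^ N * (1 + ‖B.symm u‖) ^ N := by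
  refine ⟨1 + ‖(B : Phase d →L[ℝ] Phase d)‖, by positivity, fun N u => ?_⟩
  rw [← mul_pow]
  gcongr
  have h := (B : Phase d →L[ℝ] Phase d).le_opNorm (B.symm u)
  simp only [ContinuousLinearEquiv.coe_coe, ContinuousLinearEquiv.apply_symm_apply] at h
  nlinarith [norm_nonneg (B.symm u), norm_nonneg (B : Phase d →L[ℝ] Phase d)]

theorem Intertwines.decay {W : L2 d ≃ₗᵢ[ℂ] L2 d} {B : Phase d ≃L[ℝ] Phase d}
    (h : Intertwines W B) (φ : 𝓢(Config d, ℂ)) (N : ℕ) :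
    ∃ q : Seminorm ℂ 𝓢(Config d, ℂ), Continuous q ∧ ∀ (f : 𝓢(Config d, ℂ)) z,
      (1 + ‖z‖) ^ N * ‖stftFun (W (φ.toLp 2 volume)) (W (f.toLp 2 volume)) z‖ ≤ q f := by
  obtain ⟨β, hβ, hB⟩ := one_add_norm_pow_le_symm B
  obtain ⟨q, hq, hqf⟩ := stftFun_decay φ N
  lift β to ℝ≥0 using hβ
  refine ⟨(β ^ N) • q, hq.const_smul (β ^ N), fun f z => ?_⟩
  have h1 := h.norm_stftFun (φ.toLp 2 volume) (f.toLp 2 volume) (B.symm z)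
  rw [B.apply_symm_apply, ← stftFun_schwartz_eq] at h1
  have h2 : ((β ^ N) • q) f = (β : ℝ) ^ N * q f := by
    rw [← NNReal.coe_pow]; rfl
  rw [h1, h2]
  calc _ ≤ (β ^ N * (1 + ‖B.symm z‖) ^ N) * ‖stftFun φ f (B.symm z)‖ := by
        gcongr
        exact hB N z
    _ ≤ _ := by
        rw [mul_assoc]
        gcongr
        exact hqf _ _

theorem integral_weight_le {F : Phase d → ℂ} {K : ℝ} (N : ℕ)
    (hF : ∀ z, (1 + ‖z‖) ^ (N + (volume : Measure (Phase d)).integrablePower) * ‖F z‖ ≤ K) :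
    ∫ z, (1 + ‖z‖) ^ N * ‖F z‖ ≤ (∫ z : Phase d, (1 + ‖z‖) ^
      (-((volume : Measure (Phase d)).integrablePower : ℝ))) * K := by
  rw [← integral_mul_const]
  refine integral_mono_of_nonneg (Filter.Eventually.of_forall fun z => by positivity)
    ((Measure.integrable_pow_neg_integrablePower volume).mul_const K)
    (Filter.Eventually.of_forall fun z => ?_)
  have hx : 0 < 1 + ‖z‖ := by positivity
  simp only
  rw [Real.rpow_neg hx.le, Real.rpow_natCast, mul_comm _ K, ← div_eq_mul_inv,
    le_div_iff₀ (by positivity)]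
  have := hF z
  rw [pow_add] at this
  linarith

theorem Intertwines.exists_schwartz {W : L2 d ≃ₗᵢ[ℂ] L2 d} {B : Phase d ≃L[ℝ] Phase d}
    (h : Intertwines W B) (f : 𝓢(Config d, ℂ)) :
    ∃ Φ : 𝓢(Config d, ℂ), Φ.toLp 2 volume = W (f.toLp 2 volume) := by
  by_cases hf : f = 0
  · refine ⟨0, ?_⟩
    have h0 : (0 : 𝓢(Config d, ℂ)).toLp 2 volume = 0 := map_zero (toLpCLM ℂ ℂ 2 volume)
    rw [hf, h0, map_zero]
  set u : L2 d := W (f.toLp 2 volume) with hu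
  have hum : StronglyMeasurable u := Lp.stronglyMeasurable u
  have hu0 : ¬ (u : Config d → ℂ) =ᵐ[volume] 0 := fun h0 => by
    have h1 : u = 0 := (Lp.eq_zero_iff_ae_eq_zero).2 h0
    rw [hu, LinearIsometryEquiv.map_eq_zero_iff] at h1
    apply hf
    apply injective_toLp 2 volume
    simp only [h1]
    exact (map_zero (toLpCLM ℂ ℂ 2 volume)).symm
  have hamb : ∀ N : ℕ, Integrable fun z => (1 + ‖z‖) ^ N * ‖stftFun u u z‖ :=
    integrable_of_decay (stronglyMeasurable_stftFun hum hum).aestronglyMeasurable fun N => by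
      obtain ⟨q, -, hq⟩ := h.decay f N
      exact ⟨q f, hq f⟩
  -- The window is `f` itself, a nonzero Schwartz function already at hand.
  have hdec := integrable_of_decay (μ := (volume : Measure (Phase d)))
    (stronglyMeasurable_stftFun f.stronglyMeasurable hum).aestronglyMeasurable
    (stftFun_decay_of_ambiguity hum (Lp.memLp u) hu0 hamb hf)
  obtain ⟨Φ, hΦ, -⟩ := exists_schwartz_of_stftFun hf hum (Lp.memLp u) hdec
  exact ⟨Φ, Lp.ext ((Φ.coeFn_toLp 2 volume).trans hΦ.symm)⟩

theorem toLp_injective {f g : 𝓢(Config d, ℂ)}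
    (h : (f.toLp 2 volume : L2 d) = g.toLp 2 volume) : f = g :=
  injective_toLp 2 volume h

/-- An isometry of `L²` that intertwines time-frequency shifts restricts to a continuous operator
on the Schwartz space. -/
theorem Intertwines.exists_schwartzCLM {W : L2 d ≃ₗᵢ[ℂ] L2 d} {B : Phase d ≃L[ℝ] Phase d}
    (h : Intertwines W B) :
    ∃ P : 𝓢(Config d, ℂ) →L[ℂ] 𝓢(Config d, ℂ),
      ∀ f, (P f).toLp 2 volume = W (f.toLp 2 volume) := by
  choose P hP using h.exists_schwartz
  have hadd : ∀ f g : 𝓢(Config d, ℂ), (f + g).toLp 2 (volume : Measure (Config d)) =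
      f.toLp 2 volume + g.toLp 2 volume := map_add (toLpCLM ℂ ℂ 2 volume)
  have hsmul : ∀ (c : ℂ) (f : 𝓢(Config d, ℂ)), (c • f).toLp 2 (volume : Measure (Config d)) =
      c • f.toLp 2 volume := map_smul (toLpCLM ℂ ℂ 2 volume)
  let L : 𝓢(Config d, ℂ) →ₗ[ℂ] 𝓢(Config d, ℂ) :=
    { toFun := P
      map_add' := fun f g => toLp_injective (by rw [hP, hadd, hadd, hP, hP, map_add])
      map_smul' := fun c f => toLp_injective (by
        rw [hP, hsmul, RingHom.id_apply, hsmul, hP, map_smul]) }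
  refine ⟨⟨L, ?_⟩, hP⟩
  -- Splitting here provides a nonzero window without constructing one.
  by_cases htriv : ∀ f : 𝓢(Config d, ℂ), f = 0
  · have : (L : 𝓢(Config d, ℂ) → 𝓢(Config d, ℂ)) = fun _ => 0 := funext fun f => htriv _
    change Continuous L
    rw [this]
    exact continuous_const
  push Not at htriv
  obtain ⟨φ, hφ⟩ := htriv
  have hPφ : P φ ≠ 0 := fun h0 => by
    apply hφ
    apply toLp_injective
    have h1 := hP φ
    have h2 : (0 : 𝓢(Config d, ℂ)).toLp 2 (volume : Measure (Config d)) = 0 :=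
      map_zero (toLpCLM ℂ ℂ 2 volume)
    rw [h0, h2] at h1
    rw [h2]
    exact (W.map_eq_zero_iff).1 h1.symm
  refine (schwartz_withSeminorms ℂ (Config d) ℂ).continuous_of_continuous_comp L fun i => ?_
  -- With window `P φ`, the transform of `P f` has the modulus of `V_φ f` moved by `B`, so its decay
  -- is controlled by a seminorm of `f`.
  obtain ⟨C, hC, hCf⟩ := seminorm_le_integral_stftFun hPφ i.1 i.2
  obtain ⟨q, hq, hqf⟩ := h.decay φ (i.1 + i.2 + (volume : Measure (Phase d)).integrablePower)
  obtain ⟨I, hI⟩ : ∃ I : ℝ≥0, (I : ℝ) = C * ∫ z : Phase d, (1 + ‖z‖) ^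
      (-((volume : Measure (Phase d)).integrablePower : ℝ)) :=
    ⟨⟨_, mul_nonneg hC (integral_nonneg fun z => by positivity)⟩, rfl⟩
  refine Seminorm.continuous_of_le (q := I • q) (hq.const_smul I) fun f => ?_
  have h1 : (I • q) f = (I : ℝ) * q f := rfl
  rw [h1, hI, mul_assoc]
  refine (hCf (P f)).trans ?_
  gcongr
  refine integral_weight_le _ fun z => ?_
  rw [stftFun_schwartz_eq, hP, hP]
  exact hqf f z

/-! ### Tempered distributions as superpositions -/

/-- The bound lets `f` factor through the range of `J`; Hahn–Banach extends the factor to `H`, and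
Riesz represents it. -/
theorem exists_inner_representation {E H : Type*} [AddCommGroup E] [Module ℂ E]
    [NormedAddCommGroup H] [InnerProductSpace ℂ H] [CompleteSpace H] (J : E →ₗ[ℂ] H)
    (f : E →ₗ[ℂ] ℂ) {C : ℝ} (h : ∀ x, ‖f x‖ ≤ C * ‖J x‖) :
    ∃ y : H, ∀ x, f x = inner ℂ y (J x) := by
  have hker : LinearMap.ker J ≤ LinearMap.ker f := fun x hx => by
    rw [LinearMap.mem_ker] at hx ⊢
    have := h x
    rw [hx, norm_zero, mul_zero] at this
    exact norm_le_zero_iff.1 this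
  let f' : LinearMap.range J →ₗ[ℂ] ℂ :=
    (LinearMap.ker J).liftQ f hker ∘ₗ J.quotKerEquivRange.symm.toLinearMap
  have hf' : ∀ x, f' ⟨J x, LinearMap.mem_range_self J x⟩ = f x := fun x => by
    simp [f', LinearMap.quotKerEquivRange_symm_apply_image]
  obtain ⟨G, hG, -⟩ := exists_extension_norm_eq (LinearMap.range J) (f'.mkContinuous C (by
    rintro ⟨-, x, rfl⟩
    exact (hf' x).symm ▸ h x))
  refine ⟨(InnerProductSpace.toDual ℂ H).symm G, fun x => ?_⟩
  rw [InnerProductSpace.toDual_symm_apply, ← hf']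
  exact (hG ⟨J x, LinearMap.mem_range_self J x⟩).symm

theorem integral_mul_norm_le {α : Type*} [MeasurableSpace α] {μ : Measure α} {w : α → ℝ}
    {g : α → ℂ} (hw : MemLp w 2 μ) (hg : MemLp g 2 μ) :
    ∫ a, w a * ‖g a‖ ∂μ ≤ (eLpNorm w 2 μ).toReal * (eLpNorm g 2 μ).toReal := by
  have h := real_inner_le_norm (hw.toLp w) (hg.norm.toLp fun a => ‖g a‖)
  rw [L2.inner_def, Lp.norm_toLp, Lp.norm_toLp, eLpNorm_norm] at h
  refine le_trans (le_of_eq (integral_congr_ae ?_)) h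
  filter_upwards [hw.coeFn_toLp, hg.norm.coeFn_toLp] with a h1 h2
  rw [h1, h2]
  simp [mul_comm]

theorem stftFun_add (φ f g : 𝓢(Config d, ℂ)) (z : Phase d) :
    stftFun φ (f + g : 𝓢(Config d, ℂ)) z = stftFun φ f z + stftFun φ g z := by
  rw [stftFun, stftFun, stftFun, ← integral_add (norm_integral_mul_conj_le (f.memLp 2) (φ.memLp 2) z).1
    (norm_integral_mul_conj_le (g.memLp 2) (φ.memLp 2) z).1]
  simp [add_mul]

theorem stftFun_smul (c : ℂ) (φ f : 𝓢(Config d, ℂ)) (z : Phase d) :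
    stftFun φ (c • f : 𝓢(Config d, ℂ)) z = c * stftFun φ f z := by
  rw [stftFun, stftFun, ← integral_const_mul]
  simp [mul_assoc]

theorem memLp_weight_stftFun (φ f : 𝓢(Config d, ℂ)) (M : ℕ) :
    MemLp (fun z => ((1 + ‖z‖ : ℝ) ^ M : ℂ) * stftFun φ f z) 2 := by
  have hm : AEStronglyMeasurable (fun z : Phase d => ((1 + ‖z‖ : ℝ) ^ M : ℂ) * stftFun φ f z) :=
    (Continuous.aestronglyMeasurable (by fun_prop)).mul (stronglyMeasurable_stftFun
      φ.stronglyMeasurable f.stronglyMeasurable).aestronglyMeasurable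
  rw [memLp_two_iff_integrable_sq_norm hm]
  obtain ⟨q, -, hq⟩ := stftFun_decay φ M
  refine ((integrable_weight_stftFun φ f M).const_mul (q f)).mono' (hm.norm.pow 2)
    (Filter.Eventually.of_forall fun z => ?_)
  have h1 : ‖((1 + ‖z‖ : ℝ) ^ M : ℂ) * stftFun φ f z‖ = (1 + ‖z‖) ^ M * ‖stftFun φ f z‖ := by
    rw [norm_mul, norm_pow, Complex.norm_real, Real.norm_of_nonneg (by positivity)]
  rw [Real.norm_of_nonneg (by positivity), h1, sq]
  gcongr
  exact hq f z

theorem memLp_weight_inv (d : ℕ) : MemLp (fun z : Phase d =>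
    ((1 + ‖z‖) ^ (volume : Measure (Phase d)).integrablePower)⁻¹) 2 := by
  have hc : Continuous fun z : Phase d =>
      ((1 + ‖z‖) ^ (volume : Measure (Phase d)).integrablePower)⁻¹ :=
    Continuous.inv₀ (by fun_prop) fun z => by positivity
  rw [memLp_two_iff_integrable_sq_norm hc.aestronglyMeasurable]
  refine (Measure.integrable_pow_neg_integrablePower (volume : Measure (Phase d))).mono'
    (hc.norm.pow 2).aestronglyMeasurable (Filter.Eventually.of_forall fun z => ?_)
  have hx : 1 ≤ 1 + ‖z‖ := by linarith [norm_nonneg z]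
  rw [Real.rpow_neg (by positivity), Real.rpow_natCast, norm_pow, norm_norm,
    Real.norm_of_nonneg (by positivity)]
  exact pow_le_of_le_one (by positivity) (inv_le_one_of_one_le₀ (one_le_pow₀ hx)) two_ne_zero

/-- Every tempered distribution is a superposition of time-frequency shifts of a given window, with
coefficients of polynomial growth in the mean. -/
theorem exists_stftFun_representation {φ : 𝓢(Config d, ℂ)} (hφ : φ ≠ 0) (f : 𝓢'(Config d, ℂ)) :
    ∃ (κ : Phase d → ℂ) (L : ℕ), StronglyMeasurable κ ∧
      Integrable (fun z => ((1 + ‖z‖) ^ L)⁻¹ * ‖κ z‖) ∧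
      ∀ ψ : 𝓢(Config d, ℂ), f ψ = ∫ z, κ z * stftFun φ ψ z := by
  let r := (volume : Measure (Phase d)).integrablePower
  obtain ⟨s, C, -, hfs⟩ := Seminorm.bound_of_continuous (schwartz_withSeminorms ℂ (Config d) ℂ)
    ((normSeminorm ℂ ℂ).comp (f : 𝓢(Config d, ℂ) →ₗ[ℂ] ℂ)) (continuous_norm.comp f.continuous)
  choose D hD hDf using fun i : ℕ × ℕ => seminorm_le_integral_stftFun hφ i.1 i.2
  let M := ∑ i ∈ s, (i.1 + i.2)
  have hbd1 : ∀ ψ : 𝓢(Config d, ℂ), ‖f ψ‖ ≤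
      (C * ∑ i ∈ s, D i) * ∫ z, (1 + ‖z‖) ^ M * ‖stftFun φ ψ z‖ := fun ψ => by
    refine (hfs ψ).trans ?_
    change C * (s.sup (schwartzSeminormFamily ℂ (Config d) ℂ)) ψ ≤ _
    rw [mul_assoc]
    gcongr
    refine (Seminorm.finset_sup_le_sum _ s _).trans ?_
    rw [_root_.sum_apply, Finset.sum_mul]
    refine Finset.sum_le_sum fun i hi => (hDf i ψ).trans ?_
    have := hD i
    gcongr ?_ * ?_
    refine integral_mono (integrable_weight_stftFun φ ψ _) (integrable_weight_stftFun φ ψ _)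
      fun z => ?_
    have h1 : (1 : ℝ) ≤ 1 + ‖z‖ := by linarith [norm_nonneg z]
    have h2 : i.1 + i.2 ≤ M :=
      Finset.single_le_sum (f := fun i : ℕ × ℕ => i.1 + i.2) (fun _ _ => Nat.zero_le _) hi
    dsimp only
    gcongr
  let J : 𝓢(Config d, ℂ) →ₗ[ℂ] Lp ℂ 2 (volume : Measure (Phase d)) :=
    { toFun := fun ψ => (memLp_weight_stftFun φ ψ (M + r)).toLp _
      map_add' := fun ψ₁ ψ₂ => by
        rw [← MemLp.toLp_add]
        congr 1
        funext z
        simp only [stftFun_add, Pi.add_apply]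
        ring
      map_smul' := fun c ψ => by
        rw [RingHom.id_apply, ← MemLp.toLp_const_smul]
        congr 1
        funext z
        simp only [stftFun_smul, Pi.smul_apply, smul_eq_mul]
        ring }
  -- Cauchy–Schwarz trades the weighted `L¹` norm for an `L²` norm with `r` more powers of weight,
  -- bringing the functional into a Hilbert space.
  have hbd2 : ∀ ψ : 𝓢(Config d, ℂ), ‖f ψ‖ ≤ ((C * ∑ i ∈ s, D i) * (eLpNorm (fun z : Phase d =>
      ((1 + ‖z‖) ^ r)⁻¹) 2 volume).toReal) * ‖J ψ‖ := fun ψ => by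
    refine (hbd1 ψ).trans ?_
    have hJ : ‖J ψ‖ = (eLpNorm (fun z : Phase d =>
        ((1 + ‖z‖ : ℝ) ^ (M + r) : ℂ) * stftFun φ ψ z) 2 volume).toReal :=
      Lp.norm_toLp _ (memLp_weight_stftFun φ ψ (M + r))
    have hS : 0 ≤ C * ∑ i ∈ s, D i := mul_nonneg C.2 (Finset.sum_nonneg fun i _ => hD i)
    rw [hJ]
    refine (mul_le_mul_of_nonneg_left ?_ hS).trans (mul_assoc _ _ _).ge
    refine le_trans (le_of_eq ?_)
      (integral_mul_norm_le (memLp_weight_inv d) (memLp_weight_stftFun φ ψ (M + r)))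
    refine integral_congr_ae (Filter.Eventually.of_forall fun z => ?_)
    simp only [norm_mul, norm_pow, Complex.norm_real, r]
    rw [Real.norm_of_nonneg (by positivity), pow_add]
    field_simp
  obtain ⟨y, hy⟩ := exists_inner_representation J (f : 𝓢(Config d, ℂ) →ₗ[ℂ] ℂ) hbd2
  -- The coefficient absorbs the weight of `J`. A further `r` powers in the denominator make it
  -- integrable, as a product of two `L²` functions.
  refine ⟨fun z => conj (y z) * ((1 + ‖z‖ : ℝ) ^ (M + r) : ℂ), M + r + r, ?_, ?_, fun ψ => ?_⟩
  · exact (Complex.continuous_conj.comp_stronglyMeasurable (Lp.stronglyMeasurable y)).mul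
      (Continuous.stronglyMeasurable (by fun_prop))
  · refine ((memLp_weight_inv d).integrable_mul (Lp.memLp y).norm).congr
      (Filter.Eventually.of_forall fun z => ?_)
    simp only [Pi.mul_apply, norm_mul, norm_pow, Complex.norm_real, RCLike.norm_conj]
    rw [Real.norm_of_nonneg (by positivity), pow_add _ (M + r) r]
    field_simp
    exact mul_comm _ _
  · refine (hy ψ).trans ?_
    rw [L2.inner_def]
    refine integral_congr_ae ?_
    filter_upwards [(memLp_weight_stftFun φ ψ (M + r)).coeFn_toLp] with z hz
    have hz' : (J ψ : Phase d → ℂ) z = ((1 + ‖z‖ : ℝ) ^ (M + r) : ℂ) * stftFun φ ψ z := hz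
    rw [hz', RCLike.inner_apply]
    ring

/-! ### Inversion and change of window for distributions -/

/-- The reflection of the frequency variable. -/
def reflect (z : Phase d) : Phase d := phaseMk (pos z) (-freq z)

theorem norm_reflect (z : Phase d) : ‖reflect z‖ = ‖z‖ := by
  have h : ‖reflect z‖ ^ 2 = ‖z‖ ^ 2 := by
    rw [norm_sq_eq_pos_freq, norm_sq_eq_pos_freq z, reflect, pos_phaseMk, freq_phaseMk, norm_neg]
  exact (pow_left_inj₀ (norm_nonneg _) (norm_nonneg _) two_ne_zero).1 h

theorem conjS_conjS (g : 𝓢(Config d, ℂ)) : conjS (conjS g) = g := by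
  ext t
  simp [conjS_apply]

theorem conjS_tfShiftS (z : Phase d) (g : 𝓢(Config d, ℂ)) :
    conjS (tfShiftS z g) = tfShiftS (reflect z) (conjS g) := by
  ext t
  rw [conjS_apply, tfShiftS_apply, tfShiftS_apply]
  simp only [tfShift, modFactor_eq_fourierChar, reflect, pos_phaseMk, freq_phaseMk, map_mul,
    conjS_apply, inner_neg_right, AddChar.map_neg_eq_inv, Circle.coe_inv_eq_conj]

theorem norm_stftFun_conjS_tfShiftS_le (φ ψ : 𝓢(Config d, ℂ)) (N : ℕ) :
    ∃ (C : ℝ) (M : ℕ), 0 ≤ C ∧ ∀ z u,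
      (1 + ‖u‖) ^ N * ‖stftFun ψ (conjS (tfShiftS z φ)) u‖ ≤ C * (1 + ‖z‖) ^ M := by
  obtain ⟨C, M, hC, h⟩ := norm_stftFun_tfShiftS_le (conjS φ) ψ N
  refine ⟨C, M, hC, fun z u => ?_⟩
  rw [conjS_tfShiftS, ← norm_reflect z]
  exact h _ u

theorem stronglyMeasurable_stftFun_conjS (φ ψ : 𝓢(Config d, ℂ)) :
    StronglyMeasurable fun p : Phase d × Phase d => stftFun ψ (conjS (tfShiftS p.1 φ)) p.2 := by
  simp only [stftFun, conjS_apply, tfShiftS_apply]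
  refine StronglyMeasurable.integral_prod_right
    (f := fun (p : Phase d × Phase d) t => conj (tfShift p.1 φ t) * conj (tfShift p.2 ψ t)) ?_
  have h1 : StronglyMeasurable fun p : (Phase d × Phase d) × Config d => tfShift p.1.1 φ p.2 :=
    (stronglyMeasurable_tfShift φ.stronglyMeasurable).comp_measurable
      (g := fun p : (Phase d × Phase d) × Config d => (p.1.1, p.2)) (by fun_prop)
  have h2 : StronglyMeasurable fun p : (Phase d × Phase d) × Config d => tfShift p.1.2 ψ p.2 :=
    (stronglyMeasurable_tfShift ψ.stronglyMeasurable).comp_measurable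
      (g := fun p : (Phase d × Phase d) × Config d => (p.1.2, p.2)) (by fun_prop)
  exact (Complex.continuous_conj.comp_stronglyMeasurable h1).mul
    (Complex.continuous_conj.comp_stronglyMeasurable h2)

theorem stronglyMeasurable_stft {g : 𝓢(Config d, ℂ)} (hg : g ≠ 0) (h : 𝓢(Config d, ℂ))
    (f : 𝓢'(Config d, ℂ)) : StronglyMeasurable (stft h f) := by
  obtain ⟨κ, L, hκ, -, hf⟩ := exists_stftFun_representation hg f
  have h1 : stft h f = fun z => ∫ u, κ u * stftFun g (conjS (tfShiftS z h)) u :=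
    funext fun z => hf _
  rw [h1]
  refine StronglyMeasurable.integral_prod_right
    (f := fun z u => κ u * stftFun g (conjS (tfShiftS z h)) u) ?_
  exact (hκ.comp_measurable measurable_snd).mul (stronglyMeasurable_stftFun_conjS h g)

theorem stftFun_conjS_comm (g : 𝓢(Config d, ℂ)) (z u : Phase d) :
    stftFun g (conjS (tfShiftS z g)) u = stftFun g (conjS (tfShiftS u g)) z := by
  simp only [stftFun, conjS_apply, tfShiftS_apply, mul_comm]

/-- The inversion formula for the short-time Fourier transform, tested on a Schwartz function. -/
theorem integral_stft_mul_conj_stftFun {g : 𝓢(Config d, ℂ)} (hg : g ≠ 0) (f : 𝓢'(Config d, ℂ))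
    (ψ : 𝓢(Config d, ℂ)) :
    ∫ z, stft g f z * conj (stftFun g ψ z) = conj (∫ t, g t * conj (g t)) * bracket f ψ := by
  obtain ⟨κ, L, hκ, hκi, hf⟩ := exists_stftFun_representation hg f
  obtain ⟨C, M, hC, hbd⟩ := norm_stftFun_conjS_tfShiftS_le g g L
  have hV := stronglyMeasurable_stftFun g.stronglyMeasurable ψ.stronglyMeasurable
  let A : Phase d → Phase d → ℂ := fun z u => stftFun g (conjS (tfShiftS z g)) u
  have hI : Integrable (fun p : Phase d × Phase d =>
      κ p.2 * A p.1 p.2 * conj (stftFun g ψ p.1)) (volume.prod volume) := by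
    have hprod := (integrable_weight_stftFun g ψ M).mul_prod hκi
    refine (hprod.const_mul C).mono' ?_ (Filter.Eventually.of_forall fun p => ?_)
    · have h1 : StronglyMeasurable fun p : Phase d × Phase d => κ p.2 :=
        hκ.comp_measurable measurable_snd
      have h2 : StronglyMeasurable fun p : Phase d × Phase d => conj (stftFun g ψ p.1) :=
        Complex.continuous_conj.comp_stronglyMeasurable
          (hV.comp_measurable (g := fun p : Phase d × Phase d => p.1) measurable_fst)
      exact ((h1.mul (stronglyMeasurable_stftFun_conjS g g)).mul h2).aestronglyMeasurable
    · have h1 : ‖A p.1 p.2‖ ≤ C * (1 + ‖p.1‖) ^ M * ((1 + ‖p.2‖) ^ L)⁻¹ := by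
        rw [← div_eq_mul_inv, le_div_iff₀ (by positivity), mul_comm]
        exact hbd p.1 p.2
      rw [norm_mul, norm_mul, RCLike.norm_conj]
      calc ‖κ p.2‖ * ‖A p.1 p.2‖ * ‖stftFun g ψ p.1‖
          ≤ ‖κ p.2‖ * (C * (1 + ‖p.1‖) ^ M * ((1 + ‖p.2‖) ^ L)⁻¹) * ‖stftFun g ψ p.1‖ := by gcongr
        _ = _ := by ring
  have h1 : ∀ z, stft g f z * conj (stftFun g ψ z) =
      ∫ u, κ u * A z u * conj (stftFun g ψ z) := fun z => by
    rw [integral_mul_const]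
    congr 1
    exact hf _
  simp only [h1]
  rw [integral_integral_swap hI, bracket, hf, ← integral_const_mul]
  refine integral_congr_ae (Filter.Eventually.of_forall fun u => ?_)
  have h2 := integral_stftFun_mul_conj (conjS (tfShiftS u g)).stronglyMeasurable
    g.stronglyMeasurable ((conjS (tfShiftS u g)).memLp 2) (g.memLp 2) ψ g
  have h3 : ∫ t, conjS (tfShiftS u g) t * conj (ψ t) = stftFun g (conjS ψ) u := by
    simp only [stftFun, conjS_apply, tfShiftS_apply, mul_comm]
  rw [h3] at h2
  simp only [mul_assoc, integral_const_mul]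
  -- The kernel is symmetric in `z` and `u`, so the inner integral over `z` is a pairing of two
  -- transforms with window `g` to which orthogonality applies.
  have h4 : ∀ z, A z u = stftFun g (conjS (tfShiftS u g)) z := fun z => stftFun_conjS_comm g z u
  simp only [h4, h2]
  ring

/-- Two time-frequency shifts compose to a shift by the difference up to a phase, so the
change-of-window kernel is a convolution kernel in modulus. -/
theorem norm_stftFun_tfShiftS (g h : 𝓢(Config d, ℂ)) (z w : Phase d) :
    ‖stftFun g (tfShiftS w h) z‖ = ‖stftFun h g (w - z)‖ := by
  rw [norm_stftFun_swap]
  have h1 : stftFun h (tfShiftS z g) w = (Real.fourierChar (inner ℝ (pos z) (freq z - freq w)) : ℂ) *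
      stftFun h g (w - z) := by
    rw [stftFun, ← integral_add_right_eq_self _ (pos z), stftFun, ← integral_const_mul]
    refine integral_congr_ae (Filter.Eventually.of_forall fun t => ?_)
    simp only [tfShiftS_apply, tfShift, modFactor_eq_fourierChar, add_sub_cancel_right, map_mul,
      ← Circle.coe_inv_eq_conj, ← AddChar.map_neg_eq_inv, pos_sub, freq_sub]
    have h2 : t + pos z - pos w = t - (pos w - pos z) := by abel
    rw [h2]
    have h3 : (Real.fourierChar (inner ℝ (t + pos z) (freq z)) : ℂ) *
        (Real.fourierChar (-inner ℝ (t + pos z) (freq w)) : ℂ) =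
        (Real.fourierChar (inner ℝ (pos z) (freq z - freq w)) : ℂ) *
        (Real.fourierChar (-inner ℝ t (freq w - freq z)) : ℂ) := by
      rw [← Circle.coe_mul, ← Circle.coe_mul, ← AddChar.map_add_eq_mul, ← AddChar.map_add_eq_mul]
      congr 2
      simp only [inner_add_left, inner_sub_right]
      ring
    linear_combination (g t * conj (h (t - (pos w - pos z)))) * h3
  rw [h1, norm_mul, Circle.norm_coe, one_mul]

/-- Pointwise control of the short-time Fourier transform under a change of window. -/
theorem enorm_stft_le_lintegral {g : 𝓢(Config d, ℂ)} (hg : g ≠ 0) (h : 𝓢(Config d, ℂ))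
    (f : 𝓢'(Config d, ℂ)) (w : Phase d) :
    ‖∫ t, g t * conj (g t)‖ₑ * ‖stft h f w‖ₑ ≤
      ∫⁻ z, ‖stft g f z‖ₑ * ‖stftFun h g (w - z)‖ₑ := by
  have h1 := integral_stft_mul_conj_stftFun hg f (tfShiftS w h)
  have h2 : ‖∫ t, g t * conj (g t)‖ₑ * ‖stft h f w‖ₑ =
      ‖∫ z, stft g f z * conj (stftFun g (tfShiftS w h) z)‖ₑ := by
    rw [h1, enorm_mul, RCLike.enorm_conj]
    rfl
  rw [h2]
  refine (enorm_integral_le_lintegral_enorm _).trans (le_of_eq (lintegral_congr fun z => ?_))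
  rw [enorm_mul, RCLike.enorm_conj]
  congr 1
  rw [← ofReal_norm, ← ofReal_norm, norm_stftFun_tfShiftS]

/-! ### Young's inequality -/

/-- Young's inequality for the convolution of an `L^p` function with an integrable kernel. -/
theorem eLpNorm_le_of_le_convolution {E : Type*} [NormedAddCommGroup E] [MeasurableSpace E]
    [BorelSpace E] [SecondCountableTopology E] {μ : Measure E} [SFinite μ] [μ.IsAddLeftInvariant]
    [μ.IsNegInvariant] {F a : E → ℂ} {k : E → ℝ≥0∞} (hF : Measurable F) (hk : Measurable k)
    (ha : ∀ w, ‖a w‖ₑ ≤ ∫⁻ z, ‖F z‖ₑ * k (w - z) ∂μ) {p : ℝ≥0∞} (hp : 1 ≤ p) :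
    eLpNorm a p μ ≤ (∫⁻ z, k z ∂μ) * eLpNorm F p μ := by
  set K := ∫⁻ z, k z ∂μ with hK
  have hKw : ∀ w, ∫⁻ z, k (w - z) ∂μ = K := fun w => lintegral_sub_left_eq_self k w
  have hkw : ∀ w, Measurable fun z => k (w - z) := fun w => hk.comp (by fun_prop)
  rcases eq_or_ne p ∞ with rfl | hptop
  · rw [eLpNorm_exponent_top, eLpNorm_exponent_top]
    refine eLpNormEssSup_le_of_ae_enorm_bound (Filter.Eventually.of_forall fun w => ?_)
    calc ‖a w‖ₑ ≤ ∫⁻ z, eLpNormEssSup F μ * k (w - z) ∂μ := by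
          refine (ha w).trans (lintegral_mono_ae ?_)
          filter_upwards [enorm_ae_le_eLpNormEssSup F μ] with z hz
          gcongr
      _ = K * eLpNormEssSup F μ := by
          rw [lintegral_const_mul _ (hkw w), hKw, mul_comm]
  have hp0 : p ≠ 0 := (zero_lt_one.trans_le hp).ne'
  set r := p.toReal with hr
  have hr1 : 1 ≤ r := by
    rw [hr, ← ENNReal.toReal_one]
    exact (ENNReal.toReal_le_toReal ENNReal.one_ne_top hptop).2 hp
  have hr0 : 0 < r := by linarith
  have hpt : ∀ w, ‖a w‖ₑ ^ r ≤ (∫⁻ z, ‖F z‖ₑ ^ r * k (w - z) ∂μ) * K ^ (r - 1) := fun w => by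
    -- Hölder against this measure of total mass `K` gives the pointwise bound; integrating in `w`
    -- by Tonelli then gives one more factor `K`.
    let ν := μ.withDensity fun z => k (w - z)
    have hν : ν Set.univ = K := by
      rw [withDensity_apply _ MeasurableSet.univ, Measure.restrict_univ, hKw]
    have h1 : ∀ G : E → ℝ≥0∞, Measurable G → ∫⁻ z, G z ∂ν = ∫⁻ z, G z * k (w - z) ∂μ :=
      fun G hG => by
        rw [lintegral_withDensity_eq_lintegral_mul _ (hkw w) hG]
        simp only [Pi.mul_apply, mul_comm]
    have h2 := eLpNorm'_le_eLpNorm'_mul_rpow_measure_univ (μ := ν) zero_lt_one hr1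
      hF.aestronglyMeasurable
    rw [eLpNorm'_eq_lintegral_enorm, eLpNorm'_eq_lintegral_enorm, hν] at h2
    simp only [ENNReal.rpow_one, div_one] at h2
    rw [h1 _ hF.enorm, h1 _ (hF.enorm.pow_const r)] at h2
    calc ‖a w‖ₑ ^ r ≤ ((∫⁻ z, ‖F z‖ₑ ^ r * k (w - z) ∂μ) ^ (1 / r) * K ^ (1 - 1 / r)) ^ r := by
          gcongr
          exact (ha w).trans h2
      _ = _ := by
          rw [ENNReal.mul_rpow_of_nonneg _ _ hr0.le, ← ENNReal.rpow_mul, ← ENNReal.rpow_mul,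
            one_div_mul_cancel hr0.ne', ENNReal.rpow_one]
          congr 2
          field_simp
  rw [eLpNorm_eq_lintegral_rpow_enorm_toReal hp0 hptop,
    eLpNorm_eq_lintegral_rpow_enorm_toReal hp0 hptop, ← hr]
  have hmeas : Measurable (Function.uncurry fun w z => ‖F z‖ₑ ^ r * k (w - z)) :=
    ((hF.comp measurable_snd).enorm.pow_const r).mul (hk.comp (by fun_prop))
  have hint : ∫⁻ w, ‖a w‖ₑ ^ r ∂μ ≤ K ^ r * ∫⁻ z, ‖F z‖ₑ ^ r ∂μ := by
    calc ∫⁻ w, ‖a w‖ₑ ^ r ∂μ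
        ≤ ∫⁻ w, (∫⁻ z, ‖F z‖ₑ ^ r * k (w - z) ∂μ) * K ^ (r - 1) ∂μ := lintegral_mono hpt
      _ = (∫⁻ z, ∫⁻ w, ‖F z‖ₑ ^ r * k (w - z) ∂μ ∂μ) * K ^ (r - 1) := by
          rw [lintegral_mul_const _ hmeas.lintegral_prod_right,
            lintegral_lintegral_swap hmeas.aemeasurable]
      _ = (∫⁻ z, ‖F z‖ₑ ^ r ∂μ) * K * K ^ (r - 1) := by
          congr 1
          rw [← lintegral_mul_const _ (hF.enorm.pow_const r)]
          refine lintegral_congr fun z => ?_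
          have hsub : ∫⁻ w, k (w - z) ∂μ = K := lintegral_sub_right_eq_self k z
          have hmz : Measurable fun w => k (w - z) := hk.comp (by fun_prop)
          rw [lintegral_const_mul _ hmz, hsub]
      _ = _ := by
          have h3 : K ^ r = K * K ^ (r - 1) := by
            nth_rw 2 [← ENNReal.rpow_one K]
            rw [← ENNReal.rpow_add_of_nonneg _ _ zero_le_one (by linarith)]
            congr 1
            ring
          rw [h3]
          ring
  calc (∫⁻ w, ‖a w‖ₑ ^ r ∂μ) ^ (1 / r) ≤ (K ^ r * ∫⁻ z, ‖F z‖ₑ ^ r ∂μ) ^ (1 / r) := by gcongr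
    _ = _ := by
        rw [ENNReal.mul_rpow_of_nonneg _ _ (by positivity), ← ENNReal.rpow_mul,
          mul_one_div_cancel hr0.ne', ENNReal.rpow_one]

/-! ### Symplectic maps and the extension to tempered distributions -/

theorem det_toEuclideanLin_symplectic (A : Matrix.symplecticGroup (Fin d) ℝ) :
    LinearMap.det (Matrix.toEuclideanLin (A : Matrix (Fin d ⊕ Fin d) (Fin d ⊕ Fin d) ℝ)) = 1 := by
  change LinearMap.det (Matrix.toLpLin 2 2 _) = 1
  rw [Matrix.toLpLin_eq_toLin, LinearMap.det_toLin, SymplecticGroup.det_eq_one A.2]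

/-- The action of a symplectic matrix on phase space, as a continuous linear equivalence. -/
def actEquiv (A : Matrix.symplecticGroup (Fin d) ℝ) : Phase d ≃L[ℝ] Phase d :=
  (LinearMap.equivOfDetNeZero
    (Matrix.toEuclideanLin (A : Matrix (Fin d ⊕ Fin d) (Fin d ⊕ Fin d) ℝ))
    (by rw [det_toEuclideanLin_symplectic]; exact one_ne_zero)).toContinuousLinearEquiv

theorem actEquiv_apply (A : Matrix.symplecticGroup (Fin d) ℝ) (z : Phase d) :
    actEquiv A z = act (A : Matrix _ _ ℝ) z := rfl

theorem measurePreserving_actEquiv (A : Matrix.symplecticGroup (Fin d) ℝ) :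
    MeasurePreserving (actEquiv A) := by
  refine ⟨(actEquiv A).continuous.measurable, ?_⟩
  have h := Measure.map_linearMap_addHaar_eq_smul_addHaar (volume : Measure (Phase d))
    (f := Matrix.toEuclideanLin (A : Matrix (Fin d ⊕ Fin d) (Fin d ⊕ Fin d) ℝ))
    (by rw [det_toEuclideanLin_symplectic]; exact one_ne_zero)
  rw [det_toEuclideanLin_symplectic] at h
  simpa using! h

theorem IsMetaplectic.intertwines_symm {A : Matrix.symplecticGroup (Fin d) ℝ}
    {U : L2 d ≃ₗᵢ[ℂ] L2 d} (hU : IsMetaplectic A U) : Intertwines U.symm (actEquiv A).symm := by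
  intro z
  obtain ⟨c, hc, h⟩ := hU ((actEquiv A).symm z)
  refine ⟨c, hc, fun f => ?_⟩
  rw [← actEquiv_apply, ContinuousLinearEquiv.apply_symm_apply] at h
  rw [h, map_smul, U.symm_apply_apply]

theorem tfShiftL2_toLp (z : Phase d) (φ : 𝓢(Config d, ℂ)) :
    tfShiftL2 z (φ.toLp 2 volume) = (tfShiftS z φ).toLp 2 volume := by
  refine Lp.ext ?_
  have h1 : ∀ᵐ t, (φ.toLp 2 volume : L2 d) (t - pos z) = φ (t - pos z) :=
    (measurePreserving_sub_right volume (pos z)).quasiMeasurePreserving.ae (φ.coeFn_toLp 2 volume)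
  filter_upwards [(memLp_tfShift z (Lp.memLp (φ.toLp 2 volume : L2 d))).coeFn_toLp, h1,
    (tfShiftS z φ).coeFn_toLp 2 volume] with t h2 h3 h4
  rw [tfShiftL2, h2, h4, tfShiftS_apply, tfShift, tfShift, h3]

theorem conjS_smul (c : ℂ) (φ : 𝓢(Config d, ℂ)) : conjS (c • φ) = conj c • conjS φ := by
  ext t
  simp [conjS_apply]

theorem continuous_conjS : Continuous (conjS : 𝓢(Config d, ℂ) → 𝓢(Config d, ℂ)) :=
  (postcompCLM (𝕜 := ℝ) (Complex.conjCLE : ℂ →L[ℝ] ℂ)).continuous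

/-- The conjugate `φ ↦ conj (P (conj φ))` of an operator `P` on the Schwartz space. -/
def conjCLM (P : 𝓢(Config d, ℂ) →L[ℂ] 𝓢(Config d, ℂ)) : 𝓢(Config d, ℂ) →L[ℂ] 𝓢(Config d, ℂ) where
  toFun φ := conjS (P (conjS φ))
  map_add' φ ψ := by
    have h : ∀ φ ψ : 𝓢(Config d, ℂ), conjS (φ + ψ) = conjS φ + conjS ψ := fun φ ψ => by
      ext t
      simp [conjS_apply]
    rw [h, map_add, h]
  map_smul' c φ := by
    rw [conjS_smul, map_smul, conjS_smul, Complex.conj_conj, RingHom.id_apply]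
  cont := continuous_conjS.comp (P.continuous.comp continuous_conjS)

theorem conjCLM_apply (P : 𝓢(Config d, ℂ) →L[ℂ] 𝓢(Config d, ℂ)) (φ : 𝓢(Config d, ℂ)) :
    conjCLM P φ = conjS (P (conjS φ)) := rfl

theorem toTemperedDistribution_eq_inner (f : L2 d) (φ : 𝓢(Config d, ℂ)) :
    Lp.toTemperedDistribution f φ = inner ℂ ((conjS φ).toLp 2 volume : L2 d) f := by
  rw [Lp.toTemperedDistribution_apply, L2.inner_def]
  refine integral_congr_ae ?_
  filter_upwards [(conjS φ).coeFn_toLp 2 volume] with t ht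
  rw [ht, RCLike.inner_apply, conjS_apply, Complex.conj_conj, smul_eq_mul, mul_comm]

/-- The distributional pairing is bilinear and the `L²` product sesquilinear. The transpose of the
conjugated operator is therefore the adjoint of `U⁻¹`, which is `U`. -/
theorem isTemperedExtension_precomp {U : L2 d ≃ₗᵢ[ℂ] L2 d}
    {P : 𝓢(Config d, ℂ) →L[ℂ] 𝓢(Config d, ℂ)}
    (hP : ∀ f : 𝓢(Config d, ℂ), (P f).toLp 2 volume = U.symm (f.toLp 2 volume)) :
    IsTemperedExtension U (PointwiseConvergenceCLM.precomp ℂ (conjCLM P)) := by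
  intro f
  ext φ
  have h : PointwiseConvergenceCLM.precomp ℂ (conjCLM P) (Lp.toTemperedDistribution f) φ =
      Lp.toTemperedDistribution f (conjCLM P φ) := rfl
  rw [h, toTemperedDistribution_eq_inner, toTemperedDistribution_eq_inner, conjCLM_apply,
    conjS_conjS, hP, ← U.inner_map_map, U.apply_symm_apply]

theorem norm_stft_precomp {W : L2 d ≃ₗᵢ[ℂ] L2 d} {B : Phase d ≃L[ℝ] Phase d}
    (hW : Intertwines W B) {P : 𝓢(Config d, ℂ) →L[ℂ] 𝓢(Config d, ℂ)}
    (hP : ∀ f : 𝓢(Config d, ℂ), (P f).toLp 2 volume = W (f.toLp 2 volume))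
    (g : 𝓢(Config d, ℂ)) (f : 𝓢'(Config d, ℂ)) (z : Phase d) :
    ‖stft g (PointwiseConvergenceCLM.precomp ℂ (conjCLM P) f) z‖ = ‖stft (P g) f (B z)‖ := by
  obtain ⟨c, hc, h⟩ := hW z
  have h1 : P (tfShiftS z g) = c • tfShiftS (B z) (P g) := by
    apply toLp_injective
    have h2 : (c • tfShiftS (B z) (P g)).toLp 2 (volume : Measure (Config d)) =
        c • (tfShiftS (B z) (P g)).toLp 2 volume := map_smul (toLpCLM ℂ ℂ 2 volume) _ _
    rw [hP, h2, ← tfShiftL2_toLp, ← tfShiftL2_toLp, hP, h]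
  have h3 : stft g (PointwiseConvergenceCLM.precomp ℂ (conjCLM P) f) z =
      f (conjS (P (tfShiftS z g))) := by
    rw [← conjS_conjS (tfShiftS z g)]
    simp only [conjS_conjS]
    change f (conjCLM P (conjS (tfShiftS z g))) = _
    rw [conjCLM_apply, conjS_conjS]
  rw [h3, h1, conjS_smul, map_smul, norm_smul, RCLike.norm_conj, hc, one_mul]
  rfl

/-! ### Moderate weights and modulation norms -/

theorem polyWeight_le {s : ℝ} (hs : 0 ≤ s) (z : Phase d) : polyWeight s z ≤ (1 + ‖z‖) ^ ⌈s⌉₊ := by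
  have h1 : 1 ≤ 1 + ‖z‖ := by linarith [norm_nonneg z]
  calc polyWeight s z ≤ ((1 + ‖z‖) ^ (2 : ℝ)) ^ (s / 2) := by
        unfold polyWeight
        gcongr
        rw [Real.rpow_two]
        nlinarith [norm_nonneg z]
    _ = (1 + ‖z‖) ^ s := by
        rw [← Real.rpow_mul (by positivity)]
        congr 1
        ring
    _ ≤ (1 + ‖z‖) ^ (⌈s⌉₊ : ℝ) := Real.rpow_le_rpow_of_exponent_le h1 (Nat.le_ceil s)
    _ = _ := Real.rpow_natCast _ _

/-- Moderateness survives a linear change of variables, since `B` distorts norms by a bounded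
factor. The constants are chosen before `m`, whence the uniformity of the final bound in the weight.
-/
theorem IsModerate.comp_equiv_le {s K : ℝ} (hs : 0 ≤ s) (B : Phase d ≃L[ℝ] Phase d) :
    ∃ (D : ℝ) (n : ℕ), ∀ m : Phase d → ℝ, IsModerate s K m →
      ∀ w z, m (B w) ≤ D * (1 + ‖w - z‖) ^ n * m (B z) := by
  obtain ⟨β, hβ, hB⟩ := one_add_norm_pow_le_symm B
  refine ⟨K * β ^ ⌈s⌉₊, ⌈s⌉₊, fun m hm w z => ?_⟩
  have hK : 0 ≤ K := by
    have h1 := (hm.pos 0).trans_le (by simpa using hm.moderate 0 0)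
    have h2 : polyWeight s (0 : Phase d) = 1 := by simp [polyWeight]
    rw [h2, mul_one] at h1
    exact (pos_of_mul_pos_left h1 (hm.pos 0).le).le
  have h1 := hm.moderate (B (w - z)) (B z)
  rw [← map_add, sub_add_cancel] at h1
  refine h1.trans ?_
  have h2 := hB ⌈s⌉₊ (B (w - z))
  rw [B.symm_apply_apply] at h2
  have h3 := (polyWeight_le hs (B (w - z))).trans h2
  have := (hm.pos (B z)).le
  rw [mul_assoc K (β ^ _)]
  gcongr

/-- Change of window in the modulation space norms, uniformly in the exponent and the weight. -/
theorem modNorm_le_of_window {g : 𝓢(Config d, ℂ)} (hg : g ≠ 0) (h : 𝓢(Config d, ℂ)) {s : ℝ}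
    (hs : 0 ≤ s) (K : ℝ) (B : Phase d ≃L[ℝ] Phase d) :
    ∃ C : ℝ≥0, ∀ m : Phase d → ℝ, IsModerate s K m → ∀ p : ℝ≥0∞, 1 ≤ p → ∀ f : 𝓢'(Config d, ℂ),
      modNorm h p (fun z => m (B z)) f ≤ C * modNorm g p (fun z => m (B z)) f := by
  obtain ⟨D, n, hD⟩ := IsModerate.comp_equiv_le (K := K) hs B
  set a : ℂ := ∫ t, g t * conj (g t) with ha
  have ha0 : ‖a‖ₑ ≠ 0 := by simpa using integral_mul_conj_self_ne_zero hg
  have hatop : ‖a‖ₑ ≠ ⊤ := enorm_ne_top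
  -- The absolute value is taken because `D` comes with no sign: it is fixed before any weight is
  -- given, and only a weight forces `K > 0`.
  let k : Phase d → ℝ≥0∞ := fun u =>
    ENNReal.ofReal (|D| * ((1 + ‖u‖) ^ n * ‖stftFun h g u‖))
  have hkm : Measurable k := by
    refine ENNReal.measurable_ofReal.comp (Measurable.const_mul (Measurable.mul (by fun_prop) ?_) _)
    exact (stronglyMeasurable_stftFun h.stronglyMeasurable g.stronglyMeasurable).measurable.norm
  have hktop : ∫⁻ u, k u ≠ ⊤ :=
    ((integrable_weight_stftFun h g n).const_mul |D|).lintegral_lt_top.ne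
  refine ⟨((∫⁻ u, k u) / ‖a‖ₑ).toNNReal, fun m hm p hp f => ?_⟩
  rw [ENNReal.coe_toNNReal (ENNReal.div_ne_top hktop ha0)]
  have hFm : Measurable fun z => stft g f z * (m (B z) : ℂ) :=
    (stronglyMeasurable_stft hg g f).measurable.mul
      (Complex.measurable_ofReal.comp (hm.measurable.comp B.continuous.measurable))
  have hnorm : ∀ z, ‖(m (B z) : ℂ)‖ₑ = ENNReal.ofReal (m (B z)) := fun z => by
    rw [← ofReal_norm, Complex.norm_real, Real.norm_of_nonneg (hm.pos _).le]
  have key : ∀ w, ‖a * (stft h f w * (m (B w) : ℂ))‖ₑ ≤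
      ∫⁻ z, ‖stft g f z * (m (B z) : ℂ)‖ₑ * k (w - z) := fun w => by
    rw [enorm_mul, enorm_mul, ← mul_assoc, hnorm]
    calc _ ≤ (∫⁻ z, ‖stft g f z‖ₑ * ‖stftFun h g (w - z)‖ₑ) * ENNReal.ofReal (m (B w)) := by
          gcongr
          exact enorm_stft_le_lintegral hg h f w
      _ = ∫⁻ z, ‖stft g f z‖ₑ * ‖stftFun h g (w - z)‖ₑ * ENNReal.ofReal (m (B w)) :=
          (lintegral_mul_const' _ _ ENNReal.ofReal_ne_top).symm
      _ ≤ _ := by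
          refine lintegral_mono fun z => ?_
          rw [enorm_mul, hnorm, mul_assoc, mul_assoc]
          refine mul_le_mul' le_rfl ?_
          rw [← ofReal_norm, ← ENNReal.ofReal_mul (norm_nonneg _),
            ← ENNReal.ofReal_mul (hm.pos _).le]
          refine ENNReal.ofReal_le_ofReal ?_
          have h1 := hm.pos (B z)
          calc ‖stftFun h g (w - z)‖ * m (B w)
              ≤ ‖stftFun h g (w - z)‖ * (|D| * (1 + ‖w - z‖) ^ n * m (B z)) := by
                gcongr
                refine (hD m hm w z).trans ?_
                gcongr
                exact le_abs_self D
            _ = _ := by ring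
  have hyoung := eLpNorm_le_of_le_convolution hFm hkm key hp
  have hsm : eLpNorm (fun w => a * (stft h f w * (m (B w) : ℂ))) p volume =
      ‖a‖ₑ * modNorm h p (fun z => m (B z)) f :=
    eLpNorm_const_smul a (fun w => stft h f w * (m (B w) : ℂ)) p volume
  rw [hsm] at hyoung
  rw [ENNReal.div_eq_inv_mul, mul_assoc, ← ENNReal.inv_mul_cancel_left ha0 hatop
    (b := modNorm h p (fun z => m (B z)) f)]
  exact mul_le_mul' le_rfl hyoung

/-- Transport of the modulation space norm along a measure preserving map of phase space. -/
theorem modNorm_eq_of_norm_stft_eq {g h : 𝓢(Config d, ℂ)} (hg : g ≠ 0) {f f' : 𝓢'(Config d, ℂ)}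
    {B : Phase d → Phase d} (hB : MeasurePreserving B)
    (hf : ∀ z, ‖stft g f' (B z)‖ = ‖stft h f z‖) {m : Phase d → ℝ} (hm : Measurable m)
    (p : ℝ≥0∞) : modNorm g p m f' = modNorm h p (fun z => m (B z)) f := by
  have hmeas : AEStronglyMeasurable (fun z => stft g f' z * (m z : ℂ)) volume :=
    ((stronglyMeasurable_stft hg g f').measurable.mul
      (Complex.measurable_ofReal.comp hm)).aestronglyMeasurable
  rw [modNorm, ← eLpNorm_comp_measurePreserving hmeas hB]
  refine eLpNorm_congr_norm_ae (Filter.Eventually.of_forall fun z => ?_)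
  simp only [Function.comp_apply, norm_mul, hf]

end TimeFreq

end

theorem mainTheorem2 (d : ℕ) (A : Matrix.symplecticGroup (Fin d) ℝ)
    (U : TimeFreq.L2 d ≃ₗᵢ[ℂ] TimeFreq.L2 d) (hU : TimeFreq.IsMetaplectic A U) :
    ∃ T : 𝓢'(TimeFreq.Config d, ℂ) →L[ℂ] 𝓢'(TimeFreq.Config d, ℂ),
      TimeFreq.IsTemperedExtension U T ∧
      ∀ (g : 𝓢(TimeFreq.Config d, ℂ)), g ≠ 0 →
      ∀ (s : ℝ), 0 ≤ s → ∀ (K : ℝ), ∃ C : ℝ≥0,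
      ∀ (m : TimeFreq.Phase d → ℝ), TimeFreq.IsModerate s K m →
      ∀ (p : ℝ≥0∞), 1 ≤ p →
      ∀ f ∈ TimeFreq.modSpace g p (fun z => m (TimeFreq.act A z)),
        T f ∈ TimeFreq.modSpace g p m ∧
        TimeFreq.modNorm g p m (T f) ≤ C * TimeFreq.modNorm g p (fun z => m (TimeFreq.act A z)) f := by
  obtain ⟨P, hP⟩ := hU.intertwines_symm.exists_schwartzCLM
  refine ⟨PointwiseConvergenceCLM.precomp ℂ (TimeFreq.conjCLM P),
    TimeFreq.isTemperedExtension_precomp hP, fun g hg s hs K => ?_⟩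
  obtain ⟨C, hC⟩ := TimeFreq.modNorm_le_of_window hg (P g) hs K (TimeFreq.actEquiv A)
  refine ⟨C, fun m hm p hp f hf => ?_⟩
  have h1 := TimeFreq.modNorm_eq_of_norm_stft_eq (h := P g) (f := f)
    (f' := PointwiseConvergenceCLM.precomp ℂ (TimeFreq.conjCLM P) f) hg
    (TimeFreq.measurePreserving_actEquiv A) (fun z => by
      rw [TimeFreq.norm_stft_precomp hU.intertwines_symm hP,
        ContinuousLinearEquiv.symm_apply_apply]) hm.measurable p
  have h2 := h1.trans_le (hC m hm p hp f)
  refine ⟨⟨?_, h2.trans_lt (ENNReal.mul_lt_top ENNReal.coe_lt_top hf.2)⟩, h2⟩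
  exact ((TimeFreq.stronglyMeasurable_stft hg g _).measurable.mul
    (Complex.measurable_ofReal.comp hm.measurable)).aestronglyMeasurable
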